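/- **Setting.** Let $d\in\{2,3\}$, let $\Omega\subset\mathbb R^d$ be open and bounded, with $\partial\Omega=\partial\Omega_D\cup\partial\Omega_N$ a disjoint decomposition into measurable sets, $|\partial\Omega_D|>0$. Let $\Gamma=\bigcup_{k=1}^{N}\gamma_k\subset\Omega$, $N\ge 2$, be a network of open, bounded, connected subsets $\gamma_k$ of hyperplanes (fractures) such that $\bar\gamma_i\cap\bar\gamma_j=\mathcal I_\cap:=\bigcap_k\bar\gamma_k$ for all $i\ne j$, where $\mathcal I_\cap$ is a point if $d=2$ and a segment if $d=3$, and $\mathcal I_\cap\subset\partial\gamma_k$ for every $k$. Here $\partial\gamma_k$ is the boundary of $\gamma_k$ in its hyperplane; put $\partial\gamma_k^D=\partial\gamma_k\cap\partial\Omega_D$. On $\gamma_k$ let an aperture $\ell_k\in C^1$, $\ell_k>\ell_*>0$, and a symmetric positive definite, uniformly bounded tangential permeability $\boldsymbol\nu^\tau_{\gamma_k}$, with values in $\mathbb R^{(d-1)\times(d-1)}$, be given. All gradients below are tangential. **Mesh.** A mesh $\Gamma_h$ subdivides each $\gamma_k$ into finitely many disjoint open $(d-1)$-simplices $F$ (segments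 if $d=2$, triangles, possibly with hanging nodes, if $d=3$), on each of which $\ell_k\boldsymbol\nu^\tau_{\gamma_k}$ is constant; write $K_F$ for its value, $\bar\nu_F=|K_F^{1/2}|_2^2$, $h_F$ for the diameter of $F$, and let $k_F\ge1$ be a polynomial degree. The edges are points if $d=2$ (integrals over them are evaluations) and segments if $d=3$: the set $\mathcal E^I$ of interior edges $\bar e=\partial F^+\cap\partial F^-$ inside a fracture; the set $\mathcal E^\cap$ of intersection edges $\bar e=\partial F^1\cap\dots\cap\partial F^N$, $F^k\subset\gamma_k$; and the remaining boundary edges, which match the subdivision of $\partial\gamma_k$ into its parts on $\partial\Omega_D$, on $\partial\Omega_N$, and immersed tips; $\mathcal E^D$ is the set of those on $\partial\gamma_k^D$. The mesh is *polytopic-regular* with constant $\rho$ if each $F$ contains non-overlapping $(d-1)$-simplices $S_e$, one for each edge $e\subset\partial F$, with $\bar e=\partial F\cap\bar S_e$ and $h_F\le\rho\,(d-1)|S_e|/|e|$. **Spaces.** $Q_h^\Gamma$ consists of the $q=(q_1,\dots,q_N)$ with $q_k|_F$ a polynomial of total degree at most $k_F$ for every $F\subset\gamma_k$. $Q^\Gamma$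 consists of the $q\in\prod_kH^1(\gamma_k)$ with $q_k=0$ on $\partial\gamma_k^D$ and $q_1=\dots=q_N$ on $\mathcal I_\cap$ (traces). Let $Q^\Gamma(h)=Q_h^\Gamma+\bigl(Q^\Gamma\cap H^2(\Gamma_h)\bigr)$, with $H^2(\Gamma_h)$ the functions that are $H^2$ on each element. Let $\boldsymbol\Pi$ be, on each $F$, the componentwise $L^2$-projection onto polynomials of degree at most $k_F$, and let $\mathbf f_q=K_F\boldsymbol\Pi(\nabla q)$ on $F$. **Jumps and averages.** On $\mathcal E^I$, $[\![q]\!]=q^+\mathbf n^++q^-\mathbf n^-$ and $\{\mathbf v\}=\frac12(\mathbf v^++\mathbf v^-)$; on $\mathcal E^D$, $[\![q]\!]=q\,\mathbf n$ and $\{\mathbf v\}=\mathbf v$; on $\mathcal E^\cap$, $$[\![q]\!]=(q_i-q_k)_{i<k},\qquad \{\mathbf v\}=\tfrac1N(\mathbf v_i\cdot\boldsymbol\tau_i-\mathbf v_k\cdot\boldsymbol\tau_k)_{i<k},$$ where $\mathbf n$ is the outward unit normal of the element, in its plane, and $\boldsymbol\tau_k$ is the unit vector in the plane of $\gamma_k$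 normal to the edge and pointing out of $\gamma_k$. **Penalty, form and norm.** With $\sigma_0^\Gamma>0$, let $$\sigma_e=\sigma_0^\Gamma\max_F\frac{\bar\nu_F(k_F+1)(k_F+d-1)}{h_F},$$ the maximum being over the two elements adjacent to $e$ if $e\in\mathcal E^I$, over the single adjacent element if $e\in\mathcal E^D$, and over the $N$ elements $F^1,\dots,F^N$ meeting at $e$ if $e\in\mathcal E^\cap$. With $\mathcal E=\mathcal E^I\cup\mathcal E^D\cup\mathcal E^\cap$ put $$\tilde{\mathcal A}_\Gamma(p,q)=\sum_F\int_FK_F\nabla p\cdot\nabla q-\int_{\mathcal E}\{\mathbf f_p\}\cdot[\![q]\!]-\int_{\mathcal E}\{\mathbf f_q\}\cdot[\![p]\!]+\int_{\mathcal E}\sigma_e[\![p]\!]\cdot[\![q]\!],$$ $$\|q\|_{\Gamma,DG}^2=\sum_F\|K_F^{1/2}\nabla q\|_{L^2(F)}^2+\int_{\mathcal E}\sigma_e\,|[\![q]\!]|^2 .$$ **Claim.** Fix the network, the coefficients and $\rho>0$. 1. (Continuity) For every $\sigma_0^\Gamma>0$ there is $C>0$ such that, for every polytopic-regular mesh with constant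 $\rho$, all degrees $k_F\ge1$ and all $p,q\in Q^\Gamma(h)$, $$|\tilde{\mathcal A}_\Gamma(p,q)|\le C\,\|q\|_{\Gamma,DG}\,\|p\|_{\Gamma,DG}.$$ 2. (Coercivity) There are $\sigma_{\min}>0$ and $\alpha>0$ such that, for every $\sigma_0^\Gamma\ge\sigma_{\min}$, every polytopic-regular mesh with constant $\rho$, all degrees $k_F\ge1$ and all $q\in Q^\Gamma(h)$, $$\tilde{\mathcal A}_\Gamma(q,q)\ge\alpha\,\|q\|_{\Gamma,DG}^2 .$$ -/

import Mathlib

open MeasureTheory Set Filter Topology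
open scoped ContDiff ENNReal RealInnerProductSpace

namespace FractureDG

/-- Euclidean space `ℝᵐ`. -/
abbrev E (m : ℕ) : Type := EuclideanSpace ℝ (Fin m)

/-! ### Simplices -/

/-- Closed simplex with the given vertices. -/
def closedSimplex {m : ℕ} {ι : Type} (v : ι → E m) : Set (E m) := convexHull ℝ (range v)

/-- Open simplex with the given vertices. -/
def openSimplex {m : ℕ} {ι : Type} (v : ι → E m) : Set (E m) := interior (closedSimplex v)

/-! ### Sobolev functions, traces, polynomials and the `L²` projection -/

/-- `u ∈ L²(V)` has the weak gradient `g ∈ L²(V; ℝᵐ)` in the open set `V`. -/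
def HasWeakGrad {m : ℕ} (V : Set (E m)) (u : E m → ℝ) (g : E m → E m) : Prop :=
  MemLp u 2 (volume.restrict V) ∧ MemLp g 2 (volume.restrict V) ∧
    ∀ φ : E m → ℝ, ContDiff ℝ ∞ φ → HasCompactSupport φ → tsupport φ ⊆ V →
      ∫ x in V, u x • gradient φ x = -∫ x in V, φ x • g x

/-- `u ∈ H¹(V)`. -/
def MemH1 {m : ℕ} (V : Set (E m)) (u : E m → ℝ) : Prop := ∃ g, HasWeakGrad V u g

/-- `u ∈ H²(V)`. -/
def MemH2 {m : ℕ} (V : Set (E m)) (u : E m → ℝ) : Prop :=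
  ∃ g, HasWeakGrad V u g ∧ ∀ c : Fin m, MemH1 V (fun x => g x c)

open Classical in
/-- The weak gradient of `u ∈ H¹(V)` (unique almost everywhere in `V`). -/
noncomputable def weakGrad {m : ℕ} (V : Set (E m)) (u : E m → ℝ) : E m → E m :=
  if h : ∃ g, HasWeakGrad V u g then h.choose else 0

/-- `w ∈ L²(e)` is the trace of `u ∈ H¹(V)` on the `(m-1)`-dimensional piece `e` of `∂V`:
there are functions, smooth up to the boundary, that converge to `u` in `H¹(V)` and
whose restrictions to `e` converge to `w` in `L²(e)`. -/
def IsTrace {m : ℕ} (V e : Set (E m)) (u w : E m → ℝ) : Prop :=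
  MemLp w 2 (μHE[m - 1].restrict e) ∧
    ∃ φ : ℕ → E m → ℝ, (∀ j, ContDiff ℝ ∞ (φ j)) ∧
      Tendsto (fun j => eLpNorm (fun x => φ j x - u x) 2 (volume.restrict V)) atTop (𝓝 0) ∧
      Tendsto (fun j => eLpNorm (fun x => gradient (φ j) x - weakGrad V u x) 2
        (volume.restrict V)) atTop (𝓝 0) ∧
      Tendsto (fun j => eLpNorm (fun x => φ j x - w x) 2 (μHE[m - 1].restrict e)) atTop (𝓝 0)

open Classical in
/-- The trace on `e` of `u ∈ H¹(V)` (unique almost everywhere on `e`). -/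
noncomputable def trace {m : ℕ} (V e : Set (E m)) (u : E m → ℝ) : E m → ℝ :=
  if h : ∃ w, IsTrace V e u w then h.choose else 0

/-- The function on `ℝᵐ` given by a polynomial in `m` variables. -/
noncomputable def polyFun {m : ℕ} (P : MvPolynomial (Fin m) ℝ) (x : E m) : ℝ :=
  MvPolynomial.eval (fun c => x c) P

/-- The vector field on `ℝᵐ` with the polynomial components `P`. -/
noncomputable def polyField {m : ℕ} (P : Fin m → MvPolynomial (Fin m) ℝ) (x : E m) : E m :=
  WithLp.toLp 2 (fun c => polyFun (P c) x)

/-- `P` is the `L²(V)`-orthogonal projection of the vector field `g` onto the vector fields whose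
components are polynomials of total degree at most `r`. -/
def IsPolyProj {m : ℕ} (V : Set (E m)) (r : ℕ) (g : E m → E m)
    (P : Fin m → MvPolynomial (Fin m) ℝ) : Prop :=
  ∀ c : Fin m, (P c).totalDegree ≤ r ∧
    ∀ R : MvPolynomial (Fin m) ℝ, R.totalDegree ≤ r →
      ∫ x in V, (g x c - polyFun (P c) x) * polyFun R x = 0

open Classical in
/-- The `L²(V)`-orthogonal projection of `g` onto vector polynomials of degree at most `r`,
as a function on all of `ℝᵐ`, so that its trace is its restriction. -/
noncomputable def polyProj {m : ℕ} (V : Set (E m)) (r : ℕ) (g : E m → E m) : E m → E m :=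
  if h : ∃ P, IsPolyProj V r g P then polyField h.choose else 0

/-- `ν` is the unit normal on the flat piece `e` of the boundary of the convex set `V` that
points out of `V`. -/
def IsOutwardNormal {m : ℕ} (V e : Set (E m)) (ν : E m) : Prop :=
  ‖ν‖ = 1 ∧ ∀ x ∈ e, ∀ y ∈ V, ⟪y - x, ν⟫ ≤ 0

open Classical in
/-- The outward unit normal of `V` on `e`. -/
noncomputable def outwardNormal {m : ℕ} (V e : Set (E m)) : E m :=
  if h : ∃ ν, IsOutwardNormal V e ν then h.choose else 0

/-! ### Matrices -/

/-- A matrix acting on a vector of Euclidean space. -/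
noncomputable def matAct {m : ℕ} (A : Matrix (Fin m) (Fin m) ℝ) (v : E m) : E m :=
  Matrix.toEuclideanCLM (n := Fin m) (𝕜 := ℝ) A v

open scoped MatrixOrder in
/-- The positive semidefinite square root of a positive semidefinite matrix. -/
noncomputable def matSqrt {m : ℕ} (A : Matrix (Fin m) (Fin m) ℝ) : Matrix (Fin m) (Fin m) ℝ :=
  CFC.sqrt A

/-- `|√A|₂²`, with `|·|₂` the matrix norm induced by the Euclidean norm. -/
noncomputable def sqrtNormSq {m : ℕ} (A : Matrix (Fin m) (Fin m) ℝ) : ℝ :=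
  ‖Matrix.toEuclideanCLM (n := Fin m) (𝕜 := ℝ) (matSqrt A)‖ ^ 2

/-! ### The fracture network -/

/-- A network of `N` planar fractures in a bounded open set `Ω ⊆ ℝᵈ`. The fracture `γₖ` is the image
of the open set `dom k ⊆ ℝᵈ⁻¹` under the affine isometry `emb k`, which provides Cartesian
coordinates in its plane; tangential differential operators are expressed in them. -/
structure FractureNetwork (d N : ℕ) where
  Ω : Set (E d)
  isOpen_Ω : IsOpen Ω
  isBounded_Ω : Bornology.IsBounded Ω
  /-- Dirichlet part of `∂Ω` -/
  bdD : Set (E d)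
  /-- Neumann part of `∂Ω` -/
  bdN : Set (E d)
  measurableSet_bdD : MeasurableSet bdD
  measurableSet_bdN : MeasurableSet bdN
  bdD_union_bdN : bdD ∪ bdN = frontier Ω
  disjoint_bdD_bdN : Disjoint bdD bdN
  bdD_pos : 0 < μHE[d - 1] bdD
  dom : Fin N → Set (E (d - 1))
  emb : Fin N → E (d - 1) →ᵃⁱ[ℝ] E d
  isOpen_dom : ∀ k, IsOpen (dom k)
  isBounded_dom : ∀ k, Bornology.IsBounded (dom k)
  isConnected_dom : ∀ k, IsConnected (dom k)
  frac_subset : ∀ k, emb k '' dom k ⊆ Ω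
  /-- all the fractures meet in one and the same set -/
  inter_pair : ∀ i j, i ≠ j → closure (emb i '' dom i) ∩ closure (emb j '' dom j) =
    ⋂ k, closure (emb k '' dom k)
  /-- the intersection is a point if `d = 2` and a segment if `d = 3` -/
  inter_simplex : ∃ v : Fin (d - 1) → E d, AffineIndependent ℝ v ∧
    (⋂ k, closure (emb k '' dom k)) = closedSimplex v
  /-- the intersection is part of the boundary of each fracture -/
  inter_subset : ∀ k, (⋂ j, closure (emb j '' dom j)) ⊆ emb k '' frontier (dom k)

/-- Types of edges on the boundary of a fracture, other than intersection edges. -/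
inductive BdryKind
  | dirichlet
  | neumann
  | tip

namespace FractureNetwork

variable {d N : ℕ} (G : FractureNetwork d N)

/-- `∂γₖ^∩`, the part of `∂γₖ` shared with the other fractures (in the coordinates of `γₖ`). -/
def bdInter (k : Fin N) : Set (E (d - 1)) :=
  {x | x ∈ frontier (G.dom k) ∧ ∃ j, j ≠ k ∧ G.emb k x ∈ G.emb j '' frontier (G.dom j)}

/-- `∂γₖ^D`, `∂γₖ^N` and the immersed tips `∂γₖ^F` (in the coordinates of `γₖ`). -/
def bdryPart (k : Fin N) : BdryKind → Set (E (d - 1))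
  | .dirichlet => {x | x ∈ frontier (G.dom k) ∧ G.emb k x ∈ G.bdD}
  | .neumann => {x | x ∈ frontier (G.dom k) ∧ G.emb k x ∈ G.bdN}
  | .tip => {x | x ∈ frontier (G.dom k) ∧ G.emb k x ∉ G.bdD ∧ G.emb k x ∉ G.bdN ∧
      x ∉ G.bdInter k}

end FractureNetwork

/-- Physical data on the fractures: aperture `ℓₖ` and tangential permeability `νₖ^τ`. -/
structure Coefficients {d N : ℕ} (G : FractureNetwork d N) where
  aperture : Fin N → E (d - 1) → ℝ
  perm : Fin N → E (d - 1) → Matrix (Fin (d - 1)) (Fin (d - 1)) ℝ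
  aperture_contDiffOn : ∀ k, ContDiffOn ℝ 1 (aperture k) (G.dom k)
  aperture_lower : ∃ l : ℝ, 0 < l ∧ ∀ k, ∀ x ∈ G.dom k, l < aperture k x
  perm_posDef : ∀ k, ∀ x ∈ G.dom k, (perm k x).PosDef
  perm_bounded : ∃ B : ℝ, ∀ k, ∀ x ∈ G.dom k, ∀ v : E (d - 1), ‖matAct (perm k x) v‖ ≤ B * ‖v‖

/-! ### Meshes of the network -/

/-- A mesh `Γ_h` of the network: each fracture is subdivided into open simplices (segments if
`d = 2`, triangles if `d = 3`), hanging nodes being allowed. Edges inside a fracture and edges on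
the intersection are determined by the elements; the other boundary edges (points if `d = 2`,
segments if `d = 3`) are listed, each with its element and its kind, and match the subdivision of
`∂γₖ`. Everything is in the coordinates of the respective fracture. -/
structure FractureMesh {d N : ℕ} (G : FractureNetwork d N) where
  numElem : Fin N → ℕ
  vert : ∀ k, Fin (numElem k) → Fin d → E (d - 1)
  vert_indep : ∀ k i, AffineIndependent ℝ (vert k i)
  elem_subset : ∀ k i, openSimplex (vert k i) ⊆ G.dom k
  elem_disjoint : ∀ k i j, i ≠ j → Disjoint (openSimplex (vert k i)) (openSimplex (vert k j))
  elem_cover : ∀ k, closure (G.dom k) = ⋃ i, closedSimplex (vert k i)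
  numBdry : ℕ
  bdryOwner : Fin numBdry → Σ k, Fin (numElem k)
  bdryKind : Fin numBdry → BdryKind
  bdryVert : Fin numBdry → Fin (d - 1) → E (d - 1)
  bdryVert_indep : ∀ b, AffineIndependent ℝ (bdryVert b)
  bdry_subset : ∀ b, closedSimplex (bdryVert b) ⊆
    frontier (openSimplex (vert (bdryOwner b).1 (bdryOwner b).2))
  bdry_kind : ∀ b, μHE[d - 2]
    (closedSimplex (bdryVert b) \ G.bdryPart (bdryOwner b).1 (bdryKind b)) = 0
  bdry_disjoint : ∀ b b', b ≠ b' → bdryOwner b = bdryOwner b' →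
    μHE[d - 2] (closedSimplex (bdryVert b) ∩ closedSimplex (bdryVert b')) = 0
  bdry_cover : ∀ k i, μHE[d - 2] ((frontier (openSimplex (vert k i)) ∩ frontier (G.dom k)) \
    (G.bdInter k ∪ ⋃ b, ⋃ (_ : bdryOwner b = ⟨k, i⟩), closedSimplex (bdryVert b))) = 0

namespace FractureMesh

variable {d N : ℕ} {G : FractureNetwork d N} (M : FractureMesh G)

/-- The open element `F = (k, i)` of the fracture `γₖ`. -/
def elem (k : Fin N) (i : Fin (M.numElem k)) : Set (E (d - 1)) := openSimplex (M.vert k i)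

/-- `h_F` -/
noncomputable def elemDiam (k : Fin N) (i : Fin (M.numElem k)) : ℝ := Metric.diam (M.elem k i)

/-- The part inside `γₖ` of the interface of two elements of `γₖ`; this is an edge in `E^I` when it
has positive `(d-2)`-dimensional measure, and does not contribute to any integral otherwise. -/
def interiorEdge (k : Fin N) (i j : Fin (M.numElem k)) : Set (E (d - 1)) :=
  frontier (M.elem k i) ∩ frontier (M.elem k j) ∩ G.dom k

/-- The listed boundary edge number `b`. -/
def bdryEdge (b : Fin M.numBdry) : Set (E (d - 1)) := closedSimplex (M.bdryVert b)

/-- The set `∂F¹ ∩ … ∩ ∂Fᴺ` in `ℝᵈ`, where `Fᵏ` is the element number `T k` of `γₖ`; this is an edge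
in `E^∩` when it has positive `(d-2)`-dimensional measure, and does not contribute to any integral
otherwise. -/
def interEdge (T : ∀ k, Fin (M.numElem k)) : Set (E d) :=
  ⋂ k, G.emb k '' frontier (M.elem k (T k))

/-- The set `interEdge T` in the coordinates of `γₖ`. -/
def interEdgeOn (T : ∀ k, Fin (M.numElem k)) (k : Fin N) : Set (E (d - 1)) :=
  G.emb k ⁻¹' M.interEdge T

/-- Labels for the faces of an element of `γₖ`: interface with the element `j` of the same
fracture; listed boundary edge; edge on the intersection. -/
inductive FaceLabel (k : Fin N) : Type
  | interior (j : Fin (M.numElem k))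
  | boundary (b : Fin M.numBdry)
  | inter (T : ∀ l, Fin (M.numElem l))

/-- The closed set with a given label on the boundary of the element `(k, i)`, empty if the label
does not belong to this element. -/
def faceSet (k : Fin N) (i : Fin (M.numElem k)) : M.FaceLabel k → Set (E (d - 1))
  | .interior j => {x | i ≠ j ∧ x ∈ closure (M.interiorEdge k i j)}
  | .boundary b => {x | M.bdryOwner b = ⟨k, i⟩ ∧ x ∈ M.bdryEdge b}
  | .inter T => {x | T k = i ∧ x ∈ M.interEdgeOn T k}

/-- The labels of the actual faces of the element `(k, i)`. -/
def IsFace (k : Fin N) (i : Fin (M.numElem k)) (a : M.FaceLabel k) : Prop :=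
  0 < μHE[d - 2] (M.faceSet k i a)

/-- Polytopic regularity with constant `ρ`: in every element `F` there are non-overlapping
`(d-1)`-dimensional simplices `S_e`, one for each face `e` of `F`, with `ē = ∂F ∩ S̄_e` and
`h_F ≤ ρ (d-1) |S_e| / |e|`. -/
def PolytopicRegular (ρ : ℝ) : Prop :=
  ∀ k i, ∃ S : M.FaceLabel k → Fin d → E (d - 1),
    (∀ a, M.IsFace k i a →
      AffineIndependent ℝ (S a) ∧ openSimplex (S a) ⊆ M.elem k i ∧
      M.faceSet k i a = frontier (M.elem k i) ∩ closedSimplex (S a) ∧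
      M.elemDiam k i ≤ ρ * (((d : ℝ) - 1) * (volume (openSimplex (S a))).toReal /
        (μHE[d - 2] (M.faceSet k i a)).toReal)) ∧
    ∀ a a', M.IsFace k i a → M.IsFace k i a' → a ≠ a' →
      Disjoint (openSimplex (S a)) (openSimplex (S a'))

end FractureMesh

/-- A mesh with polynomial degrees `k_F ≥ 1` on which `ℓ_Γ ν_Γ^τ` is piecewise constant. -/
structure Discretization {d N : ℕ} (G : FractureNetwork d N) (c : Coefficients G) extends
    FractureMesh G where
  deg : ∀ k, Fin (numElem k) → ℕ
  one_le_deg : ∀ k i, 1 ≤ deg k i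
  /-- the value of `ℓ_Γ ν_Γ^τ` on each element -/
  coeff : ∀ k, Fin (numElem k) → Matrix (Fin (d - 1)) (Fin (d - 1)) ℝ
  coeff_eq : ∀ k i, ∀ x ∈ openSimplex (vert k i), c.aperture k x • c.perm k x = coeff k i

/-- Functions on the network: one function for each fracture, in its coordinates. Only the values
on `dom k`, up to null sets, matter. -/
abbrev NetFun (d N : ℕ) : Type := Fin N → E (d - 1) → ℝ

namespace Discretization

variable {d N : ℕ} {G : FractureNetwork d N} {c : Coefficients G} (M : Discretization G c)

/-! #### Function spaces -/

/-- The discrete space `Q_h^Γ` of piecewise polynomials. -/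
def discreteSpace : Set (NetFun d N) :=
  {q | ∀ k i, ∃ P : MvPolynomial (Fin (d - 1)) ℝ, P.totalDegree ≤ M.deg k i ∧
    ∀ᵐ x ∂(volume.restrict (M.elem k i)), q k x = polyFun P x}

/-- Trace on `e`, taken from the element `(k, i)`, of a function on the network. -/
noncomputable def tr (q : NetFun d N) (k : Fin N) (i : Fin (M.numElem k)) (e : Set (E (d - 1))) :
    E (d - 1) → ℝ :=
  trace (M.elem k i) e (q k)

/-- Trace on `interEdge T`, taken from `γₖ`, as a function of the points of `ℝᵈ`. -/
noncomputable def interTr (q : NetFun d N) (T : ∀ k, Fin (M.numElem k)) (k : Fin N) : E d → ℝ :=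
  fun y => M.tr q k (T k) (M.interEdgeOn T k) (Function.invFun (G.emb k) y)

/-- `Q^Γ ∩ H²(Γ_h)`: functions that are `H¹` on each fracture and `H²` on each element, whose trace
vanishes on the Dirichlet part of the boundary of each fracture, and whose traces from all
fractures coincide on the intersection. -/
def regularSpace : Set (NetFun d N) :=
  {q | (∀ k, MemH1 (G.dom k) (q k)) ∧
    (∀ k i, MemH2 (M.elem k i) (q k)) ∧
    (∀ b, M.bdryKind b = .dirichlet →
      ∀ᵐ x ∂(μHE[d - 2].restrict (M.bdryEdge b)),
        M.tr q (M.bdryOwner b).1 (M.bdryOwner b).2 (M.bdryEdge b) x = 0) ∧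
    ∀ (T : ∀ k, Fin (M.numElem k)) (k l : Fin N),
      ∀ᵐ y ∂(μHE[d - 2].restrict (M.interEdge T)), M.interTr q T k y = M.interTr q T l y}

/-- The extended space `Q^Γ(h)`, sum of the discrete space and of `Q^Γ ∩ H²(Γ_h)`. -/
def extendedSpace : Set (NetFun d N) :=
  {q | ∃ a ∈ M.discreteSpace, ∃ b ∈ M.regularSpace,
    ∀ k, ∀ᵐ x ∂(volume.restrict (G.dom k)), q k x = a k x + b k x}

/-! #### The penalty parameter -/

/-- `ν̄_F^τ (k_F + 1)(k_F + d - 1) / h_F` -/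
noncomputable def elemPenalty (k : Fin N) (i : Fin (M.numElem k)) : ℝ :=
  sqrtNormSq (M.coeff k i) * ((M.deg k i : ℝ) + 1) * ((M.deg k i : ℝ) + (d : ℝ) - 1) /
    M.elemDiam k i

/-- `σ^Γ` on an interior edge between the elements `i`, `j` of `γₖ`. -/
noncomputable def sigmaInterior (σ₀ : ℝ) (k : Fin N) (i j : Fin (M.numElem k)) : ℝ :=
  σ₀ * max (M.elemPenalty k i) (M.elemPenalty k j)

/-- `σ^Γ` on a Dirichlet edge. -/
noncomputable def sigmaBdry (σ₀ : ℝ) (b : Fin M.numBdry) : ℝ :=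
  σ₀ * M.elemPenalty (M.bdryOwner b).1 (M.bdryOwner b).2

/-- `σ^Γ` on an intersection edge: the maximum over the elements, one for each fracture, that meet
at the edge. -/
noncomputable def sigmaInter (σ₀ : ℝ) (T : ∀ k, Fin (M.numElem k)) : ℝ :=
  σ₀ * ⨆ k, M.elemPenalty k (T k)

/-! #### Jumps and averages -/

/-- Broken gradient on the element `(k, i)`. -/
noncomputable def grad (q : NetFun d N) (k : Fin N) (i : Fin (M.numElem k)) :
    E (d - 1) → E (d - 1) :=
  weakGrad (M.elem k i) (q k)

/-- `ν_Γ^τ ℓ_Γ Π(∇q)` on the element `(k, i)`, with `Π` the `L²` projection onto the discrete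
vector space. -/
noncomputable def flux (q : NetFun d N) (k : Fin N) (i : Fin (M.numElem k)) (x : E (d - 1)) :
    E (d - 1) :=
  matAct (M.coeff k i) (polyProj (M.elem k i) (M.deg k i) (M.grad q k i) x)

/-- `⟦q⟧ = q⁺ n⁺ + q⁻ n⁻` on an interior edge. -/
noncomputable def jump (q : NetFun d N) (k : Fin N) (i j : Fin (M.numElem k)) (x : E (d - 1)) :
    E (d - 1) :=
  M.tr q k i (M.interiorEdge k i j) x • outwardNormal (M.elem k i) (M.interiorEdge k i j) +
    M.tr q k j (M.interiorEdge k i j) x • outwardNormal (M.elem k j) (M.interiorEdge k i j)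

/-- `{ν_Γ^τ ℓ_Γ Π(∇q)}` on an interior edge. -/
noncomputable def avgFlux (q : NetFun d N) (k : Fin N) (i j : Fin (M.numElem k)) (x : E (d - 1)) :
    E (d - 1) :=
  (1 / 2 : ℝ) • (M.flux q k i x + M.flux q k j x)

/-- `⟦q⟧ = q n` on a boundary edge. -/
noncomputable def jumpBdry (q : NetFun d N) (b : Fin M.numBdry) (x : E (d - 1)) : E (d - 1) :=
  M.tr q (M.bdryOwner b).1 (M.bdryOwner b).2 (M.bdryEdge b) x •
    outwardNormal (M.elem (M.bdryOwner b).1 (M.bdryOwner b).2) (M.bdryEdge b)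

/-- `{ν_Γ^τ ℓ_Γ Π(∇q)}` on a boundary edge. -/
noncomputable def avgFluxBdry (q : NetFun d N) (b : Fin M.numBdry) (x : E (d - 1)) : E (d - 1) :=
  M.flux q (M.bdryOwner b).1 (M.bdryOwner b).2 x

/-- The component `(k, l)` of the jump `⟦q⟧_∩` on an intersection edge. -/
noncomputable def jumpInter (q : NetFun d N) (T : ∀ k, Fin (M.numElem k)) (k l : Fin N) (y : E d) :
    ℝ :=
  M.interTr q T k y - M.interTr q T l y

/-- `ν_γₖ^τ ℓₖ Π(∇qₖ) · τₖ` on an intersection edge, where `τₖ` is the unit vector in the plane of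
`γₖ` that is normal to the edge and points out of `γₖ`. -/
noncomputable def normalFluxInter (q : NetFun d N) (T : ∀ k, Fin (M.numElem k)) (k : Fin N)
    (y : E d) : ℝ :=
  ⟪M.flux q k (T k) (Function.invFun (G.emb k) y),
    outwardNormal (M.elem k (T k)) (M.interEdgeOn T k)⟫

/-- The component `(k, l)` of the average `{ν_Γ^τ ℓ_Γ Π(∇q)}_∩` on an intersection edge. -/
noncomputable def avgFluxInter (q : NetFun d N) (T : ∀ k, Fin (M.numElem k)) (k l : Fin N)
    (y : E d) : ℝ :=
  (1 / (N : ℝ)) * (M.normalFluxInter q T k y - M.normalFluxInter q T l y)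

/-! #### Integrals over the sets of edges -/

/-- `∫_{E^I} f`, for a function `f` given on each interface `(k, i, j)`. -/
noncomputable def intInterior
    (f : (k : Fin N) → Fin (M.numElem k) → Fin (M.numElem k) → E (d - 1) → ℝ) : ℝ :=
  ∑ k, ∑ i, ∑ j ∈ Finset.Ioi i, ∫ x in M.interiorEdge k i j, f k i j x ∂μHE[d - 2]

open Classical in
/-- `∫_{E^D} f`. -/
noncomputable def intDirichlet (f : Fin M.numBdry → E (d - 1) → ℝ) : ℝ :=
  ∑ b with M.bdryKind b = .dirichlet, ∫ x in M.bdryEdge b, f b x ∂μHE[d - 2]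

/-- `∫_{E^∩} f · g`, for functions `f`, `g` with one component for each pair of fractures. -/
noncomputable def intInter (f g : ((k : Fin N) → Fin (M.numElem k)) → Fin N → Fin N → E d → ℝ) :
    ℝ :=
  ∑ T, ∫ y in M.interEdge T, ∑ k, ∑ l ∈ Finset.Ioi k, f T k l y * g T k l y ∂μHE[d - 2]

/-! #### The bilinear form and the norm -/

/-- The extended bilinear form of the fracture network, with `σ₀^Γ = σ₀`. -/
noncomputable def form (σ₀ : ℝ) (p q : NetFun d N) : ℝ :=
  (∑ k, ∑ i, ∫ x in M.elem k i, ⟪matAct (M.coeff k i) (M.grad p k i x), M.grad q k i x⟫)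
  - (M.intInterior (fun k i j x => ⟪M.avgFlux p k i j x, M.jump q k i j x⟫)
    + M.intDirichlet (fun b x => ⟪M.avgFluxBdry p b x, M.jumpBdry q b x⟫)
    + M.intInter (fun T k l y => M.avgFluxInter p T k l y) (fun T k l y => M.jumpInter q T k l y))
  - (M.intInterior (fun k i j x => ⟪M.avgFlux q k i j x, M.jump p k i j x⟫)
    + M.intDirichlet (fun b x => ⟪M.avgFluxBdry q b x, M.jumpBdry p b x⟫)
    + M.intInter (fun T k l y => M.avgFluxInter q T k l y) (fun T k l y => M.jumpInter p T k l y))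
  + (M.intInterior (fun k i j x => M.sigmaInterior σ₀ k i j * ⟪M.jump p k i j x, M.jump q k i j x⟫)
    + M.intDirichlet (fun b x => M.sigmaBdry σ₀ b * ⟪M.jumpBdry p b x, M.jumpBdry q b x⟫)
    + M.intInter (fun T k l y => M.sigmaInter σ₀ T * M.jumpInter p T k l y)
        (fun T k l y => M.jumpInter q T k l y))

/-- The network DG norm `‖·‖_{Γ,DG}`. -/
noncomputable def dgNorm (σ₀ : ℝ) (q : NetFun d N) : ℝ :=
  Real.sqrt
    ((∑ k, ∑ i, ∫ x in M.elem k i, ‖matAct (matSqrt (M.coeff k i)) (M.grad q k i x)‖ ^ 2)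
    + M.intInterior (fun k i j x => M.sigmaInterior σ₀ k i j * ‖M.jump q k i j x‖ ^ 2)
    + M.intDirichlet (fun b x => M.sigmaBdry σ₀ b * ‖M.jumpBdry q b x‖ ^ 2)
    + M.intInter (fun T k l y => M.sigmaInter σ₀ T * M.jumpInter q T k l y)
        (fun T k l y => M.jumpInter q T k l y))

end Discretization

end FractureDG

/-! Write the form as E(p,q) − C(p,q) − C(q,p) + J(p,q), with E the diffusion part, C the
consistency part and J the penalty part. E and J are symmetric and positive semidefinite, and the
squared norm is E(q,q) + J(q,q). Both claims therefore follow from one estimate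
(`abs_consistencyForm_le`): for all t > 0, |C(p,q)| ≤ t κ E(p,p) + t⁻¹ J(q,q), with κ = 8ρ(3 +
2N)/σ₀ independent of mesh and degrees. Optimising in t gives continuity; making κ small by a large
σ₀ gives coercivity.

Young's inequality with weight t/σ_e reduces the estimate to the integrals of |K_F Π∇p|² over the
edges. The integrand comes from polynomials, so a trace inverse inequality applies
(`trace_inverse`): on a facet e of a simplex S, ∫_e P² ≤ 4(r+1)² (|e|/|S|) ∫_S P² for deg P ≤ r. It
is proved along the rays from the opposite vertex, where it becomes a bound for g(1)² by the
integral of x g(x)² over (0,1), which follows from an explicit reproducing kernel for evaluation at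
1.

Polytopic regularity bounds |e|/|S_e| by a multiple of 1/h_F, and σ_e absorbs the resulting factor.
Since the S_e of one element are disjoint, the sum over its faces is bounded by the energy of
K^{1/2}Π∇p on that element, however many faces hanging nodes create (`exists_face_energy`). Finally
Π is an L² contraction commuting with the constant matrix K^{1/2}, so Π can be dropped.

Regularity only provides e = ∂F ∩ S̄_e, whereas the inverse inequality needs e to be a facet of S_e.
This comes from a hyperplane that separates F from a convex part of ∂F containing e
(`exists_facet`). -/

namespace FractureDG

/-! ### The endpoint inverse inequality for polynomials in one variable -/

section Interval

open Polynomial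

/-- Repeated integration by parts. The first boundary term at 1 is the claimed value, all the others
vanish because of the zeros of `F` at 0 and 1, and the degree bound on `g` ends the process at a
constant. -/
theorem integral_iterate_derivative_mul (n : ℕ) :
    ∀ F g : ℝ[X], g.natDegree ≤ n → (∀ j ≤ n, (derivative^[j] F).eval 0 = 0) →
      (∀ j < n, (derivative^[j] F).eval 1 = 0) →
      ∫ x in (0 : ℝ)..1, g.eval x * (derivative^[n + 1] F).eval x =
        g.eval 1 * (derivative^[n] F).eval 1 := by
  induction n with
  | zero =>
    intro F g hg h0 _
    have hgc := eq_C_of_natDegree_le_zero hg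
    have h00 := h0 0 le_rfl
    have key : ∫ x in (0 : ℝ)..1, (derivative F).eval x = F.eval 1 - F.eval 0 :=
      intervalIntegral.integral_eq_sub_of_hasDerivAt (fun x _ => F.hasDerivAt x)
        (by apply Continuous.intervalIntegrable; fun_prop)
    rw [hgc]
    simp only [Function.iterate_zero, id_eq] at h00
    simp [key, h00]
  | succ n ih =>
    intro F g hg h0 h1
    have hp := intervalIntegral.integral_mul_deriv_eq_deriv_mul (a := (0 : ℝ)) (b := 1)
      (fun x _ => g.hasDerivAt x) (fun x _ => (derivative^[n + 1] F).hasDerivAt x)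
      (by apply Continuous.intervalIntegrable; fun_prop)
      (by apply Continuous.intervalIntegrable; fun_prop)
    rw [← Function.iterate_succ_apply' derivative (n + 1) F, h0 (n + 1) le_rfl,
      ih F (derivative g) ((natDegree_derivative_le g).trans (by omega))
        (fun j hj => h0 j (by omega)) (fun j hj => h1 j (by omega)), h1 n (by omega)] at hp
    simpa using hp

theorem eval_iterate_derivative_eq_coeff_taylor (F : ℝ[X]) (k : ℕ) (r : ℝ) :
    (derivative^[k] F).eval r = k.factorial * (taylor r F).coeff k := by
  rw [taylor_coeff, ← factorial_smul_hasseDeriv]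
  simp

/-- The polynomial of degree `n` that represents evaluation at `1` in `L²(0,1)`. -/
theorem exists_endpoint_kernel (n : ℕ) :
    ∃ K : ℝ[X], K.natDegree ≤ n ∧ K.eval 1 = ((n : ℝ) + 1) ^ 2 ∧
      ∀ g : ℝ[X], g.natDegree ≤ n → ∫ x in (0 : ℝ)..1, g.eval x * K.eval x = g.eval 1 := by
  -- A Rodrigues formula: the zero has order n + 1 at 0 but only n at 1, so exactly one boundary
  -- term survives. The expansions at 0 and 1 give the vanishing derivatives as well as F⁽ⁿ⁾(1) = n!
  -- and F⁽ⁿ⁺¹⁾(1) = n!(n+1)².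
  set F : ℝ[X] := X ^ (n + 1) * (X - C 1) ^ n with hF
  have hn : (n.factorial : ℝ) ≠ 0 := by positivity
  have t1 : taylor 1 F = (X + C 1) ^ (n + 1) * X ^ n := by simp [hF]
  have t0 : taylor 0 F = (X - C 1) ^ n * X ^ (n + 1) := by simp [hF, mul_comm]
  have h0 : ∀ j ≤ n, (derivative^[j] F).eval 0 = 0 := by
    intro j hj
    rw [eval_iterate_derivative_eq_coeff_taylor, t0, coeff_mul_X_pow', if_neg (by omega), mul_zero]
  have h1 : ∀ j < n, (derivative^[j] F).eval 1 = 0 := by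
    intro j hj
    rw [eval_iterate_derivative_eq_coeff_taylor, t1, coeff_mul_X_pow', if_neg (by omega), mul_zero]
  have h1n : (derivative^[n] F).eval 1 = n.factorial := by
    rw [eval_iterate_derivative_eq_coeff_taylor, t1, coeff_mul_X_pow', if_pos le_rfl, Nat.sub_self,
      coeff_X_add_C_pow]
    simp
  have h1s : (derivative^[n + 1] F).eval 1 = (n.factorial : ℝ) * (n + 1) ^ 2 := by
    rw [eval_iterate_derivative_eq_coeff_taylor, t1, coeff_mul_X_pow', if_pos (by omega),
      show n + 1 - n = 1 by omega, coeff_X_add_C_pow, Nat.factorial_succ]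
    simp
    ring
  have hdeg : F.natDegree ≤ n + 1 + n := by
    refine natDegree_mul_le.trans (add_le_add ?_ ?_)
    · simp
    · rw [natDegree_pow, natDegree_X_sub_C, mul_one]
  refine ⟨C (n.factorial : ℝ)⁻¹ * derivative^[n + 1] F, ?_, ?_, fun g hg => ?_⟩
  · refine (natDegree_C_mul_le _ _).trans ((natDegree_iterate_derivative _ _).trans (by omega))
  · rw [eval_mul, eval_C, h1s]
    field_simp
  · have := integral_iterate_derivative_mul n F g hg h0 h1
    simp only [eval_mul, eval_C]
    simp_rw [mul_left_comm _ ((n.factorial : ℝ)⁻¹)]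
    rw [intervalIntegral.integral_const_mul, this, h1n]
    field_simp

/-- Cauchy–Schwarz against the kernel `K`, whose squared L² norm is K(1) = (n+1)² by its own
reproducing property. It is carried out by expanding the integral of (a g − g(1) K)² with a =
(n+1)². -/
theorem eval_one_sq_le (n : ℕ) (g : ℝ[X]) (hg : g.natDegree ≤ n) :
    g.eval 1 ^ 2 ≤ ((n : ℝ) + 1) ^ 2 * ∫ x in (0 : ℝ)..1, g.eval x ^ 2 := by
  obtain ⟨K, hK, hK1, hrep⟩ := exists_endpoint_kernel n
  set a : ℝ := ((n : ℝ) + 1) ^ 2 with ha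
  have ha0 : 0 < a := by positivity
  have hpos : 0 ≤ ∫ x in (0 : ℝ)..1, (C a * g - C (g.eval 1) * K).eval x ^ 2 :=
    intervalIntegral.integral_nonneg (by norm_num) fun x _ => sq_nonneg _
  have hexp : ∫ x in (0 : ℝ)..1, (C a * g - C (g.eval 1) * K).eval x ^ 2 =
      a ^ 2 * (∫ x in (0 : ℝ)..1, g.eval x ^ 2) -
        2 * a * g.eval 1 * (∫ x in (0 : ℝ)..1, g.eval x * K.eval x) +
        g.eval 1 ^ 2 * ∫ x in (0 : ℝ)..1, K.eval x * K.eval x := by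
    rw [← intervalIntegral.integral_const_mul, ← intervalIntegral.integral_const_mul,
      ← intervalIntegral.integral_const_mul, ← intervalIntegral.integral_sub,
      ← intervalIntegral.integral_add]
    · congr 1
      ext x
      simp
      ring
    all_goals apply Continuous.intervalIntegrable; fun_prop
  rw [hexp, hrep g hg, hrep K hK, hK1] at hpos
  have : 0 ≤ a * (a * (∫ x in (0 : ℝ)..1, g.eval x ^ 2) - g.eval 1 ^ 2) := by nlinarith
  linarith [nonneg_of_mul_nonneg_right this ha0]

/-- The weight x is the Jacobian of the rays from the apex of a triangle. Only [1/2, 1] is used: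
there the weight is at least 1/2, and rescaling this interval to (0,1) costs another factor 2, hence
the 4. -/
theorem eval_one_sq_le_weighted (n : ℕ) (g : ℝ[X]) (hg : g.natDegree ≤ n) :
    g.eval 1 ^ 2 ≤ 4 * ((n : ℝ) + 1) ^ 2 * ∫ x in (0 : ℝ)..1, x * g.eval x ^ 2 := by
  have hh := eval_one_sq_le n (g.comp (C (1 / 2) + C (1 / 2) * X)) (by
    refine natDegree_comp_le.trans ?_
    have : (C (1 / 2 : ℝ) + C (1 / 2) * X).natDegree ≤ 1 := by
      rw [add_comm]; exact natDegree_linear_le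
    calc _ ≤ g.natDegree * 1 := Nat.mul_le_mul_left _ this
      _ ≤ n := by omega)
  simp only [eval_comp, eval_add, eval_mul, eval_C, eval_X] at hh
  have hsub := intervalIntegral.integral_comp_add_mul (a := 0) (b := 1)
    (fun x => g.eval x ^ 2) (c := 1 / 2) (by norm_num) (1 / 2)
  rw [hsub] at hh
  norm_num at hh
  have hint : ∀ a b : ℝ, IntervalIntegrable (fun x => x * g.eval x ^ 2) volume a b := fun a b => by
    apply Continuous.intervalIntegrable; fun_prop
  have hsplit : ∫ x in (0 : ℝ)..1, x * g.eval x ^ 2 = (∫ x in (0 : ℝ)..(1 / 2), x * g.eval x ^ 2) +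
      ∫ x in (1 / 2 : ℝ)..1, x * g.eval x ^ 2 :=
    (intervalIntegral.integral_add_adjacent_intervals (hint _ _) (hint _ _)).symm
  have h1 : 0 ≤ ∫ x in (0 : ℝ)..(1 / 2), x * g.eval x ^ 2 :=
    intervalIntegral.integral_nonneg (by norm_num) fun x hx => mul_nonneg hx.1 (sq_nonneg _)
  have h2 : (1 / 2) * ∫ x in (1 / 2 : ℝ)..1, g.eval x ^ 2 ≤
      ∫ x in (1 / 2 : ℝ)..1, x * g.eval x ^ 2 := by
    rw [← intervalIntegral.integral_const_mul]
    refine intervalIntegral.integral_mono_on (by norm_num) ?_ (hint _ _) fun x hx => ?_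
    · apply Continuous.intervalIntegrable; fun_prop
    · exact mul_le_mul_of_nonneg_right hx.1 (sq_nonneg _)
  rw [hsplit]
  have h3 : (0 : ℝ) ≤ ((n : ℝ) + 1) ^ 2 := by positivity
  nlinarith

theorem ofReal_integral_zero_one {f : ℝ → ℝ} (hf : Continuous f) (h0 : ∀ x ∈ Icc (0 : ℝ) 1, 0 ≤ f x) :
    ENNReal.ofReal (∫ x in (0 : ℝ)..1, f x) = ∫⁻ x in Icc (0 : ℝ) 1, ENNReal.ofReal (f x) := by
  rw [intervalIntegral.integral_of_le (by norm_num), ← integral_Icc_eq_integral_Ioc,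
    ofReal_integral_eq_lintegral_ofReal]
  · exact hf.continuousOn.integrableOn_compact isCompact_Icc
  · exact (ae_restrict_iff' measurableSet_Icc).2 (ae_of_all _ h0)

end Interval

/-! ### Polynomial functions along rays -/

theorem continuous_polyFun {m : ℕ} (P : MvPolynomial (Fin m) ℝ) : Continuous (polyFun P) := by
  unfold polyFun
  exact (MvPolynomial.continuous_eval P).comp (by fun_prop)

theorem exists_polynomial_along_ray {m r : ℕ} (P : MvPolynomial (Fin m) ℝ)
    (hP : P.totalDegree ≤ r) (a w : E m) :
    ∃ g : Polynomial ℝ, g.natDegree ≤ r ∧ ∀ t : ℝ, g.eval t = polyFun P (a + t • w) := by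
  refine ⟨MvPolynomial.aeval (fun i => Polynomial.C (w i) * Polynomial.X + Polynomial.C (a i)) P,
    ?_, fun t => ?_⟩
  · simpa using MvPolynomial.aeval_natDegree_le (n := 1) P hP _
      fun i => Polynomial.natDegree_linear_le
  · have hc := MvPolynomial.eval₂_comp_right (Polynomial.evalRingHom t) Polynomial.C
      (fun i => Polynomial.C (w i) * Polynomial.X + Polynomial.C (a i)) P
    rw [Polynomial.coe_evalRingHom] at hc
    rw [MvPolynomial.aeval_def, Polynomial.algebraMap_eq, hc, MvPolynomial.eval₂_map]
    unfold polyFun MvPolynomial.eval MvPolynomial.eval₂Hom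
    simp only [RingHom.coe_mk, MonoidHom.coe_mk, OneHom.coe_mk]
    congr 1
    · ext; simp
    · ext i; simp; ring

/-- A polynomial of degree at most `r` is controlled at the end of a segment by its values on it. -/
theorem polyFun_sq_le_lintegral {m r : ℕ} (P : MvPolynomial (Fin m) ℝ)
    (hP : P.totalDegree ≤ r) (a w : E m) :
    ENNReal.ofReal (polyFun P (a + w) ^ 2) ≤ ENNReal.ofReal (4 * ((r : ℝ) + 1) ^ 2) *
      ∫⁻ t in Icc (0 : ℝ) 1, ENNReal.ofReal t * ENNReal.ofReal (polyFun P (a + t • w) ^ 2) := by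
  obtain ⟨g, hg, hgP⟩ := exists_polynomial_along_ray P hP a w
  have h := eval_one_sq_le_weighted r g hg
  have h1 : g.eval 1 = polyFun P (a + w) := by simpa using hgP 1
  rw [h1] at h
  refine (ENNReal.ofReal_le_ofReal h).trans ?_
  rw [ENNReal.ofReal_mul (by positivity), ofReal_integral_zero_one (by fun_prop)
    (fun x hx => mul_nonneg hx.1 (sq_nonneg _))]
  refine mul_le_mul le_rfl ?_ zero_le zero_le
  refine (setLIntegral_congr_fun (measurableSet_Icc (a := (0 : ℝ)) (b := 1)) fun t ht => ?_).le
  simp only [← hgP]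
  rw [ENNReal.ofReal_mul ht.1]

/-! ### The trace inverse inequality on simplices -/

theorem ofReal_mul_lintegral_comp_mul_left {x : ℝ} (hx : 0 < x) {h : ℝ → ℝ≥0∞}
    (hh : Measurable h) : ENNReal.ofReal x * ∫⁻ s, h (x * s) = ∫⁻ z, h z := by
  rw [← lintegral_map (μ := volume) hh (measurable_const_mul x), Real.map_volume_mul_left hx.ne',
    lintegral_smul_measure, smul_eq_mul, ← mul_assoc, ← ENNReal.ofReal_mul hx.le,
    abs_of_pos (inv_pos.2 hx), mul_inv_cancel₀ hx.ne', ENNReal.ofReal_one, one_mul]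

/-- Integration in a cone over a segment along the rays from its apex. -/
theorem lintegral_rays_le {R : Set (ℝ × ℝ)} (hR : MeasurableSet R) {l : ℝ}
    (hsub : ∀ x ∈ Icc (0 : ℝ) 1, ∀ s ∈ Icc (0 : ℝ) l, (x, x * s) ∈ R) {f : ℝ × ℝ → ℝ≥0∞}
    (hf : Measurable f) :
    ∫⁻ s in Icc (0 : ℝ) l, ∫⁻ x in Icc (0 : ℝ) 1, ENNReal.ofReal x * f (x, x * s) ≤
      ∫⁻ p in R, f p := by
  have hm : Measurable (Function.uncurry fun s x : ℝ => ENNReal.ofReal x * f (x, x * s)) := by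
    unfold Function.uncurry
    have : Measurable fun p : ℝ × ℝ => f (p.2, p.2 * p.1) := hf.comp (by fun_prop)
    exact (by fun_prop : Measurable fun p : ℝ × ℝ => ENNReal.ofReal p.2).mul this
  rw [lintegral_lintegral_swap hm.aemeasurable, ← lintegral_indicator hR,
    Measure.volume_eq_prod, lintegral_prod _ (hf.indicator hR).aemeasurable]
  refine le_trans (setLIntegral_mono' measurableSet_Icc fun x hx => ?_) (setLIntegral_le_lintegral _ _)
  rcases hx.1.eq_or_lt with h0 | h0
  · simp [← h0]
  -- For fixed x > 0 the substitution z = x s absorbs the weight: dz = x ds.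
  rw [← ofReal_mul_lintegral_comp_mul_left h0
    (h := fun z => R.indicator f (x, z)) ((hf.indicator hR).comp (by fun_prop)),
    lintegral_const_mul _ (f := fun s => f (x, x * s)) (hf.comp (by fun_prop))]
  refine mul_le_mul le_rfl ?_ zero_le zero_le
  rw [← lintegral_indicator measurableSet_Icc]
  refine lintegral_mono fun s => ?_
  by_cases hs : s ∈ Icc (0 : ℝ) l
  · simp [hs, hsub x hx s hs]
  · simp [hs]

/-- An affine change of variables multiplies all integrals by the same constant. -/
theorem exists_lintegral_affine {m : ℕ} {X : Type*} [NormedAddCommGroup X] [NormedSpace ℝ X]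
    [FiniteDimensional ℝ X] [MeasureSpace X] [BorelSpace X]
    [(volume : Measure X).IsAddHaarMeasure] (L : X ≃L[ℝ] E m) (a : E m) :
    ∃ κ : ℝ≥0∞, κ ≠ 0 ∧ κ ≠ ⊤ ∧ ∀ (s : Set (E m)) (f : E m → ℝ≥0∞),
      ∫⁻ p in (fun p => a + L p) ⁻¹' s, f (a + L p) = κ * ∫⁻ x in s, f x := by
  have hmeas : MeasurableEmbedding fun p => a + L p :=
    (L.toHomeomorph.trans (Homeomorph.addLeft a)).measurableEmbedding
  have : (Measure.map L (volume : Measure X)).IsAddHaarMeasure := L.isAddHaarMeasure_map _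
  have hmap : Measure.map (fun p => a + L p) (volume : Measure X) =
      Measure.addHaarScalarFactor (Measure.map L (volume : Measure X)) (volume : Measure (E m)) •
        (volume : Measure (E m)) := by
    rw [← Measure.isAddLeftInvariant_eq_smul (Measure.map L (volume : Measure X)) volume,
      show (fun p => a + L p) = (fun x => a + x) ∘ L from rfl,
      ← Measure.map_map (measurable_const_add a) L.continuous.measurable, map_add_left_eq_self]
  -- The value of the factor is irrelevant: in the trace inequalities it multiplies both sides and
  -- cancels, provided it is neither 0 nor infinite.
  refine ⟨(Measure.addHaarScalarFactor (Measure.map L (volume : Measure X))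
    (volume : Measure (E m)) : ℝ≥0∞), ?_, ENNReal.coe_ne_top, fun s f => ?_⟩
  · exact_mod_cast (Measure.addHaarScalarFactor_pos_of_isAddHaarMeasure _ _).ne'
  · rw [← hmeas.lintegral_map f, ← hmeas.restrict_map, hmap, Measure.restrict_smul,
      lintegral_smul_measure]
    rfl

theorem openSimplex_ae_eq {m : ℕ} {ι : Type} (v : ι → E m) :
    (openSimplex v : Set (E m)) =ᵐ[volume] closedSimplex v :=
  interior_ae_eq_of_null_frontier ((convex_convexHull ℝ _).addHaar_frontier _)

theorem trace_inverse_one {r : ℕ} (P : MvPolynomial (Fin 1) ℝ)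
    (hP : P.totalDegree ≤ r) {a b : E 1} (hab : a ≠ b) :
    ENNReal.ofReal (polyFun P b ^ 2) * volume (segment ℝ a b) ≤
      ENNReal.ofReal (4 * ((r : ℝ) + 1) ^ 2) *
        ∫⁻ x in segment ℝ a b, ENNReal.ofReal (polyFun P x ^ 2) := by
  have hinj : Function.Injective (LinearMap.toSpanSingleton ℝ (E 1) (b - a)) := by
    intro s t h
    simpa [sub_ne_zero.2 hab.symm] using h
  let L : ℝ ≃L[ℝ] E 1 :=
    (LinearMap.linearEquivOfInjective _ hinj (by simp)).toContinuousLinearEquiv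
  have hL : ∀ t, L t = t • (b - a) := fun t => rfl
  obtain ⟨κ, hκ0, hκ, hint⟩ := exists_lintegral_affine L a
  have hpre : (fun p => a + L p) ⁻¹' segment ℝ a b = Icc 0 1 := by
    rw [segment_eq_image']
    ext t
    constructor
    · rintro ⟨s, hs, h⟩
      have : s = t := hinj (by simpa [hL] using h)
      exact this ▸ hs
    · exact fun h => ⟨t, h, rfl⟩
  have hvol := hint (segment ℝ a b) 1
  have hfun := hint (segment ℝ a b) fun x => ENNReal.ofReal (polyFun P x ^ 2)
  rw [hpre] at hvol hfun
  simp only [Pi.one_apply, lintegral_const, MeasurableSet.univ, Measure.restrict_apply, univ_inter,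
    one_mul, Real.volume_Icc, sub_zero, ENNReal.ofReal_one] at hvol
  have hkey := polyFun_sq_le_lintegral P hP a (b - a)
  rw [add_sub_cancel] at hkey
  rw [← ENNReal.mul_le_mul_iff_right hκ0 hκ, mul_left_comm, ← hvol, mul_one, mul_left_comm, ← hfun]
  refine hkey.trans (mul_le_mul le_rfl (setLIntegral_mono' measurableSet_Icc fun t ht => ?_)
    zero_le zero_le)
  rw [hL]
  exact mul_le_of_le_one_left zero_le (by simpa using ht.2)

/-- The parametrisation by arc length is an isometry, and isometries transport the Euclidean
Hausdorff measure, which on ℝ is Lebesgue measure. -/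
theorem lintegral_segment {b c : E 2} (hbc : b ≠ c) (f : E 2 → ℝ≥0∞) :
    ∫⁻ x in segment ℝ b c, f x ∂μHE[1] =
      ∫⁻ s in Icc (0 : ℝ) ‖c - b‖, f (b + s • (‖c - b‖⁻¹ • (c - b))) := by
  have hl : 0 < ‖c - b‖ := norm_pos_iff.2 (sub_ne_zero.2 hbc.symm)
  set u : E 2 := ‖c - b‖⁻¹ • (c - b) with hu
  have hu1 : ‖u‖ = 1 := by rw [hu, norm_smul, norm_inv, norm_norm, inv_mul_cancel₀ hl.ne']
  have hiso : Isometry fun s : ℝ => b + s • u := by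
    refine Isometry.of_dist_eq fun s t => ?_
    rw [dist_add_left, dist_eq_norm, ← sub_smul, norm_smul, hu1, mul_one, Real.dist_eq,
      Real.norm_eq_abs]
  have hemb := hiso.isClosedEmbedding.measurableEmbedding
  have hseg : segment ℝ b c = (fun s : ℝ => b + s • u) '' Icc 0 ‖c - b‖ := by
    rw [segment_eq_image']
    ext x
    constructor
    · rintro ⟨t, ht, rfl⟩
      refine ⟨t * ‖c - b‖, ⟨by have := ht.1; positivity, by nlinarith [ht.2]⟩, ?_⟩
      simp only [hu, smul_smul, mul_assoc, mul_inv_cancel₀ hl.ne', mul_one]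
    · rintro ⟨s, hs, rfl⟩
      refine ⟨s * ‖c - b‖⁻¹, ⟨by have := hs.1; positivity, ?_⟩, ?_⟩
      · rw [← div_eq_mul_inv]; exact (div_le_one hl).2 hs.2
      · simp only [hu, smul_smul]
  have hvol : (μHE[1] : Measure ℝ) = volume := by
    have := InnerProductSpace.euclideanHausdorffMeasure_eq_volume (V := ℝ)
    rwa [Module.finrank_self] at this
  have hpre : (fun s : ℝ => b + s • u) ⁻¹' segment ℝ b c = Icc 0 ‖c - b‖ := by
    rw [hseg, preimage_image_eq _ hiso.injective]
  have hmap := hiso.map_euclideanHausdorffMeasure (d := 1)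
  have hr : (μHE[1] : Measure (E 2)).restrict (segment ℝ b c) =
      Measure.map (fun s : ℝ => b + s • u) (volume.restrict (Icc 0 ‖c - b‖)) := by
    rw [← hpre, ← hemb.restrict_map, ← hvol, hmap, Measure.restrict_restrict_of_subset]
    rw [hseg]; exact image_subset_range _ _
  rw [hr, hemb.lintegral_map]

/-- The triangle is swept out by the rays from `a` to the points b + s u of the opposite edge. In
the coordinates a + x(b − a) + z u such a ray consists of the points (x, x s), so the weighted
endpoint inequality on each ray integrates in s to the claim. -/
theorem trace_inverse_two {r : ℕ} (P : MvPolynomial (Fin 2) ℝ)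
    (hP : P.totalDegree ≤ r) {a b c : E 2} (hind : LinearIndependent ℝ ![b - a, c - b]) :
    (∫⁻ x in segment ℝ b c, ENNReal.ofReal (polyFun P x ^ 2) ∂μHE[1]) *
        volume (convexHull ℝ {a, b, c}) ≤
      ENNReal.ofReal (4 * ((r : ℝ) + 1) ^ 2) * μHE[1] (segment ℝ b c) *
        ∫⁻ x in convexHull ℝ {a, b, c}, ENNReal.ofReal (polyFun P x ^ 2) := by
  have hbc : b ≠ c := fun h => hind.ne_zero 1 (by simp [h])
  have hl : 0 < ‖c - b‖ := norm_pos_iff.2 (sub_ne_zero.2 hbc.symm)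
  have hPc := continuous_polyFun P
  have hmeas : Measurable fun x => ENNReal.ofReal (polyFun P x ^ 2) := by fun_prop
  set l := ‖c - b‖ with hldef
  set u : E 2 := l⁻¹ • (c - b) with hu
  set S := convexHull ℝ {a, b, c} with hS
  have hSm : MeasurableSet S :=
    ((Set.toFinite {a, b, c}).isCompact_convexHull (𝕜 := ℝ)).measurableSet
  let L₀ : ℝ × ℝ →ₗ[ℝ] E 2 :=
    (LinearMap.toSpanSingleton ℝ (E 2) (b - a)).coprod (LinearMap.toSpanSingleton ℝ (E 2) u)
  have hinj : Function.Injective L₀ := by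
    rw [← LinearMap.ker_eq_bot, LinearMap.ker_eq_bot']
    rintro ⟨x, z⟩ h
    have h' : x • (b - a) + (z * l⁻¹) • (c - b) = 0 := by
      simpa [L₀, hu, smul_smul] using h
    obtain ⟨h1, h2⟩ := LinearIndependent.pair_iff.1 hind _ _ h'
    simp [hl.ne'] at h2
    simp [h1, h2]
  let L : (ℝ × ℝ) ≃L[ℝ] E 2 :=
    (LinearMap.linearEquivOfInjective L₀ hinj (by simp)).toContinuousLinearEquiv
  have hL : ∀ p, L p = p.1 • (b - a) + p.2 • u := fun p => rfl
  obtain ⟨κ, hκ0, hκ, hint⟩ := exists_lintegral_affine L a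
  set R := (fun p => a + L p) ⁻¹' S with hR
  have hRm : MeasurableSet R := (by fun_prop : Continuous fun p => a + L p).measurable hSm
  have hlu : l • u = c - b := by rw [hu, smul_smul, mul_inv_cancel₀ hl.ne', one_smul]
  have hRsub : R ⊆ Icc 0 1 ×ˢ Icc 0 l := by
    have hconv : Convex ℝ ((fun p => a + L p) '' (Icc (0 : ℝ) 1 ×ˢ Icc (0 : ℝ) l)) := by
      have := (((convex_Icc (0 : ℝ) 1).prod (convex_Icc (0 : ℝ) l)).is_linear_image
        L.toLinearEquiv.toLinearMap.isLinear).translate a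
      rwa [image_image] at this
    have hsub : S ⊆ (fun p => a + L p) '' (Icc (0 : ℝ) 1 ×ˢ Icc (0 : ℝ) l) := by
      refine convexHull_min ?_ hconv
      rintro x (rfl | rfl | rfl)
      · exact ⟨(0, 0), by simp [hl.le], by simp⟩
      · exact ⟨(1, 0), by simp [hl.le], by simp [hL]⟩
      · exact ⟨(1, l), by simp [hl.le], by simp [hL, hlu]⟩
    intro p hp
    obtain ⟨q, hq, h⟩ := hsub hp
    rwa [← L.injective (add_left_cancel h)]
  have hray : ∀ x ∈ Icc (0 : ℝ) 1, ∀ s ∈ Icc (0 : ℝ) l, (x, x * s) ∈ R := by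
    intro x hx s hs
    have hb : b + (s * l⁻¹) • (c - b) ∈ S := by
      refine (convex_convexHull ℝ _).add_smul_sub_mem (subset_convexHull ℝ _ (by simp))
        (subset_convexHull ℝ _ (by simp)) ⟨by have := hs.1; positivity, ?_⟩
      rw [← div_eq_mul_inv]; exact (div_le_one hl).2 hs.2
    have := (convex_convexHull ℝ _).add_smul_sub_mem
      (subset_convexHull ℝ _ (by simp) : a ∈ S) hb hx
    change a + L (x, x * s) ∈ S
    convert this using 2
    simp only [hL, hu, smul_smul]
    module
  -- The enclosing rectangle has twice the area of the triangle in these coordinates; this loss is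
  -- harmless.
  have hvol : κ * volume S ≤ ENNReal.ofReal l := by
    have := hint S 1
    simp only [Pi.one_apply, lintegral_const, MeasurableSet.univ, Measure.restrict_apply,
      univ_inter, one_mul] at this
    rw [← this]
    refine (measure_mono hRsub).trans ?_
    rw [Measure.volume_eq_prod, Measure.prod_prod]
    simp
  have hlen : μHE[1] (segment ℝ b c) = ENNReal.ofReal l := by
    have := lintegral_segment hbc 1
    simpa [← hldef] using this
  have hfun := hint S fun x => ENNReal.ofReal (polyFun P x ^ 2)
  have hmain : ∫⁻ x in segment ℝ b c, ENNReal.ofReal (polyFun P x ^ 2) ∂μHE[1] ≤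
      ENNReal.ofReal (4 * ((r : ℝ) + 1) ^ 2) *
        ∫⁻ p in R, ENNReal.ofReal (polyFun P (a + L p) ^ 2) := by
    rw [lintegral_segment hbc, ← hldef, ← hu]
    refine le_trans (lintegral_mono fun s => ?_) ((lintegral_const_mul' _ _ ENNReal.ofReal_ne_top).trans_le
      (mul_le_mul le_rfl (lintegral_rays_le hRm hray
        (f := fun p => ENNReal.ofReal (polyFun P (a + L p) ^ 2))
        (hmeas.comp (by fun_prop))) zero_le zero_le))
    have := polyFun_sq_le_lintegral P hP a (b + s • u - a)
    rw [add_sub_cancel] at this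
    have hx : ∀ x : ℝ, a + x • (b + s • u - a) = a + L (x, x * s) := fun x => by
      simp only [hL]
      module
    simpa only [hx] using this
  rw [hfun] at hmain
  rw [← ENNReal.mul_le_mul_iff_right hκ0 hκ]
  calc _ = (∫⁻ x in segment ℝ b c, ENNReal.ofReal (polyFun P x ^ 2) ∂μHE[1]) *
        (κ * volume S) := by ring
    _ ≤ _ := mul_le_mul hmain hvol zero_le zero_le
    _ = _ := by rw [hlen]; ring

/-- Polynomial trace inverse inequality on the facet of a simplex opposite to a vertex. -/
theorem trace_inverse {d : ℕ} (hd : d = 2 ∨ d = 3) {v : Fin d → E (d - 1)}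
    (hv : AffineIndependent ℝ v) (k : Fin d) {r : ℕ} (P : MvPolynomial (Fin (d - 1)) ℝ)
    (hP : P.totalDegree ≤ r) :
    (∫⁻ x in convexHull ℝ (v '' {k}ᶜ), ENNReal.ofReal (polyFun P x ^ 2) ∂μHE[d - 2]) *
        volume (openSimplex v) ≤
      ENNReal.ofReal (4 * ((r : ℝ) + 1) ^ 2) * μHE[d - 2] (convexHull ℝ (v '' {k}ᶜ)) *
        ∫⁻ x in openSimplex v, ENNReal.ofReal (polyFun P x ^ 2) := by
  rw [measure_congr (openSimplex_ae_eq v), setLIntegral_congr (openSimplex_ae_eq v)]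
  obtain rfl | rfl := hd
  · obtain ⟨j, hj, hjk⟩ : ∃ j, ({k}ᶜ : Set (Fin 2)) = {j} ∧ j ≠ k := by
      fin_cases k
      · exact ⟨1, by ext i; fin_cases i <;> simp, by simp⟩
      · exact ⟨0, by ext i; fin_cases i <;> simp, by simp⟩
    have hne : v k ≠ v j := fun h => hjk (hv.injective h.symm)
    have hcl : closedSimplex v = segment ℝ (v k) (v j) := by
      rw [closedSimplex, ← image_univ, ← union_compl_self {k}, hj, image_union, image_singleton,
        image_singleton, singleton_union, convexHull_pair]
    rw [hj, image_singleton, convexHull_singleton, hcl, Measure.restrict_singleton,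
      lintegral_smul_measure, lintegral_dirac]
    simp only [Nat.sub_self, Measure.euclideanHausdorffMeasure_zero,
      Measure.hausdorffMeasure_zero_singleton, one_smul, mul_one]
    exact trace_inverse_one P hP hne
  · obtain ⟨i, j, hij, hki, hkj, hne⟩ :
        ∃ i j, ({k}ᶜ : Set (Fin 3)) = {i, j} ∧ k ≠ i ∧ k ≠ j ∧ i ≠ j := by
      fin_cases k
      · exact ⟨1, 2, by ext i; fin_cases i <;> simp, by simp, by simp, by simp⟩
      · exact ⟨0, 2, by ext i; fin_cases i <;> simp, by simp, by simp, by simp⟩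
      · exact ⟨0, 1, by ext i; fin_cases i <;> simp, by simp, by simp, by simp⟩
    have hcl : closedSimplex v = convexHull ℝ {v k, v i, v j} := by
      rw [closedSimplex, ← image_univ, ← union_compl_self {k}, hij, image_union, image_singleton,
        image_pair, singleton_union]
    rw [hij, image_pair, convexHull_pair, hcl]
    refine trace_inverse_two P hP ?_
    have hlin := (affineIndependent_iff_linearIndependent_vsub ℝ v k).1 hv
    have h2 : LinearIndependent ℝ ![v i - v k, v j - v k] := by
      have := hlin.comp ![⟨i, hki.symm⟩, ⟨j, hkj.symm⟩] (by
        intro x y hxy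
        fin_cases x <;> fin_cases y <;> simp_all)
      have he : ![v i - v k, v j - v k] = (fun x : {x // x ≠ k} => v x -ᵥ v k) ∘
          ![⟨i, hki.symm⟩, ⟨j, hkj.symm⟩] := by
        ext x
        fin_cases x <;> simp
      rwa [he]
    rw [LinearIndependent.pair_iff] at h2 ⊢
    intro s t h
    have := h2 (s - t) t (by rw [← h]; module)
    exact ⟨by linarith [this.1, this.2], this.2⟩

/-! ### Faces of simplices cut out by supporting hyperplanes -/

/-- If a convex combination of points with f ≤ c attains the value c, the nonnegative terms w_i (c −
f(z_i)) sum to zero. So every point with nonzero weight lies on the hyperplane, and the others can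
be discarded. -/
theorem convexHull_inter_supporting {m : ℕ} {ι : Type} (v : ι → E m) (f : E m →ₗ[ℝ] ℝ) (c : ℝ)
    (hf : ∀ i, f (v i) ≤ c) {x : E m} (hx : x ∈ closedSimplex v) (hxc : f x = c) :
    x ∈ convexHull ℝ (v '' {i | f (v i) = c}) := by
  obtain ⟨κ, _, w, z, hw0, hw1, hz, rfl⟩ := mem_convexHull_iff_exists_fintype.1 hx
  have hz' : ∀ i, f (z i) ≤ c := fun i => by
    obtain ⟨j, hj⟩ := hz i
    exact hj ▸ hf j
  have hsum : ∑ i, w i * (c - f (z i)) = 0 := by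
    simp only [map_sum, map_smul, smul_eq_mul] at hxc
    simp only [mul_sub, Finset.sum_sub_distrib, ← Finset.sum_mul, hw1, hxc]
    ring
  have hall := (Finset.sum_eq_zero_iff_of_nonneg
    fun i _ => mul_nonneg (hw0 i) (sub_nonneg.2 (hz' i))).1 hsum
  rw [← Finset.centerMass_eq_of_sum_1 _ _ hw1, ← Finset.centerMass_filter_ne_zero]
  refine Finset.centerMass_mem_convexHull _ (fun i _ => hw0 i) ?_ fun i hi => ?_
  · rw [Finset.sum_filter_ne_zero, hw1]; exact one_pos
  · obtain ⟨j, hj⟩ := hz i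
    refine ⟨j, ?_, hj⟩
    have := (mul_eq_zero.1 (hall i (Finset.mem_univ _))).resolve_left (Finset.mem_filter.1 hi).2
    rw [mem_ofPred_eq, hj]
    linarith

theorem openSimplex_nonempty {d : ℕ} (hd : d ≠ 0) {v : Fin d → E (d - 1)}
    (hv : AffineIndependent ℝ v) : (openSimplex v).Nonempty := by
  refine interior_convexHull_nonempty_iff_affineSpan_eq_top.2
    (hv.affineSpan_eq_top_iff_card_eq_finrank_add_one.2 ?_)
  simp
  omega

theorem closure_openSimplex {d : ℕ} (hd : d ≠ 0) {v : Fin d → E (d - 1)}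
    (hv : AffineIndependent ℝ v) : closure (openSimplex v) = closedSimplex v := by
  have hcl : IsClosed (closedSimplex v) :=
    ((finite_range v).isCompact_convexHull (𝕜 := ℝ)).isClosed
  rw [openSimplex, closedSimplex, (convex_convexHull ℝ _).closure_interior_eq_closure_of_nonempty_interior
    (openSimplex_nonempty hd hv)]
  exact hcl.closure_eq

/-- With two vertices missing, nothing is left if d = 2 and at most one point, of zero length, if d
= 3. -/
theorem hausdorff_convexHull_eq_zero {d : ℕ} (hd : d = 2 ∨ d = 3) (v : Fin d → E (d - 1))
    {A : Set (Fin d)} {j k : Fin d} (hjk : j ≠ k) (hj : j ∉ A) (hk : k ∉ A) :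
    μHE[d - 2] (convexHull ℝ (v '' A)) = 0 := by
  obtain rfl | rfl := hd
  · have : A = ∅ := by
      ext i
      simp only [mem_empty_iff_false, iff_false]
      intro hi
      have h1 : i ≠ j := fun h => hj (h ▸ hi)
      have h2 : i ≠ k := fun h => hk (h ▸ hi)
      omega
    simp [this]
  · have hA : A.Subsingleton := by
      intro a ha b hb
      have h1 : a ≠ j := fun h => hj (h ▸ ha)
      have h2 : a ≠ k := fun h => hk (h ▸ ha)
      have h3 : b ≠ j := fun h => hj (h ▸ hb)
      have h4 : b ≠ k := fun h => hk (h ▸ hb)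
      omega
    rw [Measure.euclideanHausdorffMeasure_def, Measure.smul_apply]
    have := Measure.nullSingletonClass_hausdorff (X := E (3 - 1)) one_pos
    rcases hA.eq_empty_or_singleton with h | ⟨a, h⟩ <;> simp [h]

/-- A part of the boundary of a convex set that lies in a convex subset of the boundary and is cut
out by an inscribed simplex is a facet of this simplex. -/
theorem exists_facet {d : ℕ} (hd : d = 2 ∨ d = 3) {F K e : Set (E (d - 1))} (hFo : IsOpen F)
    (hFc : Convex ℝ F) (hK : Convex ℝ K) (hKF : K ⊆ closure F) (hdisj : Disjoint F K)
    {v : Fin d → E (d - 1)} (hv : AffineIndependent ℝ v) (hvF : openSimplex v ⊆ F)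
    (he : e = frontier F ∩ closedSimplex v) (heK : e ⊆ K) (hpos : 0 < μHE[d - 2] e) :
    ∃ k, e = convexHull ℝ (v '' {k}ᶜ) := by
  have hd0 : d ≠ 0 := by omega
  -- The functional is below c on F and at least c on K. As K lies in the closure of F, it equals c
  -- on K, so the hyperplane f = c supports F and carries e.
  obtain ⟨f, c, hfF, hfK⟩ := geometric_hahn_banach_open hFc hFo hK hdisj
  have hcl : ∀ x ∈ closure F, f x ≤ c := fun x hx =>
    closure_minimal (fun y hy => (hfF y hy).le) (isClosed_le f.continuous continuous_const) hx
  have hvcl : closedSimplex v ⊆ closure F := by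
    rw [← closure_openSimplex hd0 hv]; exact closure_mono hvF
  have hvi : ∀ i, f (v i) ≤ c := fun i => hcl _ (hvcl (subset_convexHull ℝ _ (mem_range_self i)))
  have heq : e = convexHull ℝ (v '' {i | f (v i) = c}) := by
    ext x
    constructor
    · intro hx
      refine convexHull_inter_supporting v f.toLinearMap c hvi (he ▸ hx).2 ?_
      exact le_antisymm (hcl x (hKF (heK hx))) (hfK x (heK hx))
    · intro hx
      have hxv : x ∈ closedSimplex v := convexHull_mono (image_subset_range _ _) hx
      have hxc : f x = c := by
        have hconv : Convex ℝ {y | f y = c} := convex_hyperplane f.toLinearMap.isLinear c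
        refine (convexHull_min ?_ hconv) hx
        rintro _ ⟨i, hi, rfl⟩
        exact hi
      rw [he]
      refine ⟨⟨hvcl hxv, fun hxi => ?_⟩, hxv⟩
      rw [hFo.interior_eq] at hxi
      exact (hfF x hxi).ne hxc
  -- The hyperplane misses exactly one vertex: at least one, since the open simplex lies in F where
  -- f < c; at most one, since otherwise e would be a null set.
  obtain ⟨k, hk⟩ : ∃ k, f (v k) ≠ c := by
    by_contra! hall
    obtain ⟨y, hy⟩ := openSimplex_nonempty hd0 hv
    have hconv : Convex ℝ {y | f y = c} := convex_hyperplane f.toLinearMap.isLinear c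
    have : f y = c := (convexHull_min (by rintro _ ⟨i, rfl⟩; exact hall i) hconv)
      (interior_subset hy)
    exact (hfF y (hvF hy)).ne this
  refine ⟨k, heq.trans ?_⟩
  congr 2
  ext i
  simp only [mem_ofPred_eq, mem_compl_iff, mem_singleton_iff]
  constructor
  · rintro hi rfl
    exact hk hi
  · intro hik
    by_contra hi
    rw [heq, hausdorff_convexHull_eq_zero hd v hik hi hk] at hpos
    exact lt_irrefl _ hpos

/-- Trace inverse inequality on a face with an inscribed simplex of height comparable to `h`. -/
theorem lintegral_face_le {d : ℕ} (hd : d = 2 ∨ d = 3) {v : Fin d → E (d - 1)}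
    (hv : AffineIndependent ℝ v) (k : Fin d) {r : ℕ} (P : MvPolynomial (Fin (d - 1)) ℝ)
    (hP : P.totalDegree ≤ r) {ρ h : ℝ} (hρ : 0 < ρ) (hh : 0 < h)
    (hle : h ≤ ρ * (((d : ℝ) - 1) * (volume (openSimplex v)).toReal /
        (μHE[d - 2] (convexHull ℝ (v '' {k}ᶜ))).toReal)) :
    ∫⁻ x in convexHull ℝ (v '' {k}ᶜ), ENNReal.ofReal (polyFun P x ^ 2) ∂μHE[d - 2] ≤
      ENNReal.ofReal (8 * ρ * (((r : ℝ) + 1) * ((r : ℝ) + d - 1) / h)) *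
        ∫⁻ x in openSimplex v, ENNReal.ofReal (polyFun P x ^ 2) := by
  have key := trace_inverse hd hv k P hP
  set m := μHE[d - 2] (convexHull ℝ (v '' {k}ᶜ))
  set V := volume (openSimplex v)
  have hd1 : (1 : ℝ) ≤ (d : ℝ) - 1 ∧ (d : ℝ) - 1 ≤ 2 := by
    obtain rfl | rfl := hd <;> norm_num
  -- Division by zero gives 0, and `toReal` sends ∞ to 0. So 0 < h in the regularity inequality
  -- forces both measures to be finite and nonzero.
  have hm0 : m.toReal ≠ 0 := fun h0 => by rw [h0] at hle; simp at hle; linarith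
  have hV0 : V.toReal ≠ 0 := fun h0 => by rw [h0] at hle; simp at hle; linarith
  have hm : 0 < m.toReal := lt_of_le_of_ne ENNReal.toReal_nonneg hm0.symm
  have hmt : m ≠ ⊤ := fun h => by simp [h] at hm
  have hVt : V ≠ ⊤ := fun h => hV0 (by simp [h])
  have hVne : V ≠ 0 := fun h => hV0 (by simp [h])
  have hmV : m ≤ ENNReal.ofReal (ρ * ((d : ℝ) - 1) / h) * V := by
    rw [← ENNReal.ofReal_toReal hmt, ← ENNReal.ofReal_toReal hVt, ← ENNReal.ofReal_mul]
    · refine ENNReal.ofReal_le_ofReal ?_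
      rw [← mul_div_assoc, le_div_iff₀ hm] at hle
      rw [div_mul_eq_mul_div, le_div_iff₀ hh]
      linarith
    · have := hd1.1; positivity
  rw [← ENNReal.mul_le_mul_iff_left hVne hVt]
  refine key.trans ?_
  calc _ ≤ ENNReal.ofReal (4 * ((r : ℝ) + 1) ^ 2) * (ENNReal.ofReal (ρ * ((d : ℝ) - 1) / h) * V) *
        ∫⁻ x in openSimplex v, ENNReal.ofReal (polyFun P x ^ 2) := by gcongr
    _ = ENNReal.ofReal (4 * ((r : ℝ) + 1) ^ 2 * (ρ * ((d : ℝ) - 1) / h)) *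
        (∫⁻ x in openSimplex v, ENNReal.ofReal (polyFun P x ^ 2)) * V := by
      rw [ENNReal.ofReal_mul (p := 4 * ((r : ℝ) + 1) ^ 2) (by positivity)]; ring
    _ ≤ _ := by
      refine mul_le_mul_left (mul_le_mul_left (ENNReal.ofReal_le_ofReal ?_) _) _
      -- This trades one factor r + 1 for the r + d − 1 of the penalty parameter and turns the
      -- constant 4 into 8.
      have h1 : ((r : ℝ) + 1) * ((d : ℝ) - 1) ≤ 2 * ((r : ℝ) + d - 1) := by
        have : (0 : ℝ) ≤ r := by positivity
        nlinarith [hd1.1, hd1.2]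
      have h2 : 4 * ((r : ℝ) + 1) ^ 2 * (ρ * ((d : ℝ) - 1) / h) =
        4 * ρ * (((r : ℝ) + 1) / h) * (((r : ℝ) + 1) * ((d : ℝ) - 1)) := by ring
      have h3 : 8 * ρ * (((r : ℝ) + 1) * ((r : ℝ) + d - 1) / h) =
        4 * ρ * (((r : ℝ) + 1) / h) * (2 * ((r : ℝ) + d - 1)) := by ring
      rw [h2, h3]
      exact mul_le_mul_of_nonneg_left h1 (by positivity)

/-! ### Faces of the elements of a mesh -/

namespace FractureMesh

variable {d N : ℕ} {G : FractureNetwork d N} (M : FractureMesh G)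

theorem isOpen_elem (k : Fin N) (i : Fin (M.numElem k)) : IsOpen (M.elem k i) := isOpen_interior

theorem convex_elem (k : Fin N) (i : Fin (M.numElem k)) : Convex ℝ (M.elem k i) :=
  (convex_convexHull ℝ _).interior

theorem isBounded_elem (k : Fin N) (i : Fin (M.numElem k)) : Bornology.IsBounded (M.elem k i) :=
  (isBounded_convexHull.2 (finite_range _).isBounded).subset interior_subset

theorem elem_nonempty (hd : d ≠ 0) (k : Fin N) (i : Fin (M.numElem k)) : (M.elem k i).Nonempty :=
  openSimplex_nonempty hd (M.vert_indep k i)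

theorem elemDiam_pos (hd : d = 2 ∨ d = 3) (k : Fin N) (i : Fin (M.numElem k)) :
    0 < M.elemDiam k i := by
  have : Nontrivial (E (d - 1)) := by
    obtain rfl | rfl := hd <;> exact inferInstanceAs (Nontrivial (EuclideanSpace ℝ (Fin _)))
  obtain ⟨x, hx⟩ := M.elem_nonempty (by omega) k i
  exact Metric.diam_pos (infinite_of_mem_nhds x ((M.isOpen_elem k i).mem_nhds hx)).nontrivial
    (M.isBounded_elem k i)

theorem interEdge_subset (T : ∀ k, Fin (M.numElem k)) :
    M.interEdge T ⊆ ⋂ k, closure (G.emb k '' G.dom k) := by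
  refine iInter_mono fun k => ?_
  refine (image_mono (frontier_subset_closure.trans (closure_mono (M.elem_subset k (T k))))).trans ?_
  exact image_closure_subset_closure_image (G.emb k).continuous

/-- Provides the convex set needed to recognise a face as a facet of its inscribed simplex. For an
interface it is the intersection of two closed elements, for a listed edge the edge itself. On the
intersection it is the common point or segment, cut with the closed element; it avoids the element
because it lies on the boundary of the open fracture. -/
theorem exists_convex_faceSet_subset (k : Fin N) (i : Fin (M.numElem k)) (a : M.FaceLabel k) :
    ∃ K, Convex ℝ K ∧ K ⊆ closure (M.elem k i) ∧ Disjoint (M.elem k i) K ∧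
      M.faceSet k i a ⊆ K := by
  cases a with
  | interior j =>
    by_cases hij : i = j
    · exact ⟨∅, convex_empty, empty_subset _, disjoint_empty _, fun x hx => absurd hij hx.1⟩
    refine ⟨closure (M.elem k i) ∩ closure (M.elem k j), (M.convex_elem k i).closure.inter
      (M.convex_elem k j).closure, inter_subset_left, ?_, fun x hx => ?_⟩
    · exact ((M.elem_disjoint k i j hij).closure_right (M.isOpen_elem k i)).mono_right
        inter_subset_right
    · have hsub : M.interiorEdge k i j ⊆ closure (M.elem k i) ∩ closure (M.elem k j) :=
        fun y hy => ⟨frontier_subset_closure hy.1.1, frontier_subset_closure hy.1.2⟩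
      exact closure_minimal hsub (isClosed_closure.inter isClosed_closure) hx.2
  | boundary b =>
    by_cases hb : M.bdryOwner b = ⟨k, i⟩
    · have hsub := M.bdry_subset b
      rw [hb] at hsub
      refine ⟨M.bdryEdge b, convex_convexHull ℝ _, hsub.trans frontier_subset_closure, ?_,
        fun x hx => hx.2⟩
      exact disjoint_interior_frontier.mono (M.isOpen_elem k i).interior_eq.ge hsub
    · exact ⟨∅, convex_empty, empty_subset _, disjoint_empty _, fun x hx => absurd hx.1 hb⟩
  | inter T =>
    by_cases hT : T k = i
    · obtain ⟨v, _, hv⟩ := G.inter_simplex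
      have hinj := (G.emb k).injective
      refine ⟨G.emb k ⁻¹' (⋂ k, closure (G.emb k '' G.dom k)) ∩ closure (M.elem k i), ?_,
        inter_subset_right, ?_, fun x hx => ⟨M.interEdge_subset T hx.2, ?_⟩⟩
      · rw [hv]
        exact ((convex_convexHull ℝ _).affine_preimage (G.emb k).toAffineMap).inter
          (M.convex_elem k i).closure
      · refine Disjoint.mono_right inter_subset_left (disjoint_left.2 fun x hx hx' => ?_)
        obtain ⟨y, hy, hyx⟩ := G.inter_subset k hx'
        rw [hinj hyx] at hy
        exact disjoint_left.1 disjoint_interior_frontier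
          ((G.isOpen_dom k).interior_eq.ge (M.elem_subset k i hx)) hy
      · obtain ⟨y, hy, hyx⟩ := mem_iInter.1 hx.2 k
        rw [hinj hyx, hT] at hy
        exact frontier_subset_closure hy
    · exact ⟨∅, convex_empty, empty_subset _, disjoint_empty _, fun x hx => absurd hx.1 hT⟩

end FractureMesh

/-! ### The coefficient matrices -/

theorem matAct_apply {m : ℕ} (A : Matrix (Fin m) (Fin m) ℝ) (v : E m) (c : Fin m) :
    matAct A v c = ∑ j, A c j * v j := by
  simp [matAct, Matrix.ofLp_toEuclideanCLM, Matrix.mulVec, dotProduct]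

theorem matAct_mul {m : ℕ} (A B : Matrix (Fin m) (Fin m) ℝ) (v : E m) :
    matAct (A * B) v = matAct A (matAct B v) := by
  simp [matAct]

open scoped MatrixOrder in
theorem matSqrt_mul_self {m : ℕ} {A : Matrix (Fin m) (Fin m) ℝ} (hA : A.PosSemidef) :
    matSqrt A * matSqrt A = A :=
  CFC.sqrt_mul_sqrt_self A hA.nonneg

open scoped MatrixOrder in
theorem inner_matAct_matSqrt {m : ℕ} (A : Matrix (Fin m) (Fin m) ℝ) (v w : E m) :
    ⟪matAct (matSqrt A) v, w⟫ = ⟪v, matAct (matSqrt A) w⟫ := by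
  have hs : star (matSqrt A) = matSqrt A :=
    (IsSelfAdjoint.of_nonneg (CFC.sqrt_nonneg (a := A))).star_eq
  have h : ContinuousLinearMap.adjoint (Matrix.toEuclideanCLM (n := Fin m) (𝕜 := ℝ) (matSqrt A)) =
      Matrix.toEuclideanCLM (n := Fin m) (𝕜 := ℝ) (matSqrt A) := by
    rw [← ContinuousLinearMap.star_eq_adjoint, ← map_star, hs]
  unfold matAct
  conv_lhs => rw [← h]
  rw [ContinuousLinearMap.adjoint_inner_left]

theorem inner_matAct {m : ℕ} {A : Matrix (Fin m) (Fin m) ℝ} (hA : A.PosSemidef) (v w : E m) :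
    ⟪matAct A v, w⟫ = ⟪matAct (matSqrt A) v, matAct (matSqrt A) w⟫ := by
  conv_lhs => rw [← matSqrt_mul_self hA, matAct_mul, inner_matAct_matSqrt]

/-- Only one of the two factors √A is replaced by its norm; the other stays, to be recognised as
part of the energy. -/
theorem norm_matAct_sq_le {m : ℕ} {A : Matrix (Fin m) (Fin m) ℝ} (hA : A.PosSemidef) (v : E m) :
    ‖matAct A v‖ ^ 2 ≤ sqrtNormSq A * ‖matAct (matSqrt A) v‖ ^ 2 := by
  conv_lhs => rw [← matSqrt_mul_self hA, matAct_mul]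
  rw [sqrtNormSq, ← mul_pow]
  exact pow_le_pow_left₀ (norm_nonneg _) (ContinuousLinearMap.le_opNorm _ _) 2

theorem sqrtNormSq_pos {m : ℕ} (hm : m ≠ 0) {A : Matrix (Fin m) (Fin m) ℝ} (hA : A.PosDef) :
    0 < sqrtNormSq A := by
  have : Nonempty (Fin m) := ⟨⟨0, Nat.pos_of_ne_zero hm⟩⟩
  refine lt_of_le_of_ne (sq_nonneg _) fun h => ?_
  have h0 : matSqrt A = 0 := by
    have := norm_eq_zero.1 ((pow_eq_zero_iff two_ne_zero).1 h.symm)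
    exact (map_eq_zero_iff _ (Matrix.toEuclideanCLM (n := Fin m) (𝕜 := ℝ)).injective).1 this
  have hA0 : A = 0 := by rw [← matSqrt_mul_self hA.posSemidef, h0, mul_zero]
  have := hA.det_pos
  rw [hA0, Matrix.det_zero] at this
  exact lt_irrefl _ this

/-! ### The polynomial projection -/

theorem continuous_polyField {m : ℕ} (P : Fin m → MvPolynomial (Fin m) ℝ) :
    Continuous (polyField P) := by
  unfold polyField
  exact (PiLp.continuous_toLp 2 _).comp (continuous_pi fun c => continuous_polyFun (P c))

theorem memLp_of_continuous {m : ℕ} {V : Set (E m)} (hV : Bornology.IsBounded V)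
    {F : Type*} [NormedAddCommGroup F] {f : E m → F} (hf : Continuous f) (p : ℝ≥0∞)
    [SecondCountableTopologyEither (E m) F] :
    MemLp f p (volume.restrict V) := by
  have hc : IsCompact (closure V) := hV.isCompact_closure
  have : Fact (volume (closure V) < ⊤) := ⟨hc.measure_lt_top⟩
  obtain ⟨C, hC⟩ := hc.exists_bound_of_continuousOn hf.continuousOn
  have hb : ∀ᵐ x ∂(volume.restrict (closure V)), ‖f x‖ ≤ C :=
    (ae_restrict_mem measurableSet_closure).mono hC
  exact (MemLp.of_bound hf.aestronglyMeasurable C hb).mono_measure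
    (Measure.restrict_mono_set _ subset_closure)

theorem memLp_weakGrad {m : ℕ} (V : Set (E m)) (u : E m → ℝ) :
    MemLp (weakGrad V u) 2 (volume.restrict V) := by
  unfold weakGrad
  split_ifs with h
  · exact h.choose_spec.2.1
  · exact MemLp.zero

/-- The default value 0 is itself a polynomial field and satisfies the same stability bound, so
treating both cases avoids having to construct the projection. -/
theorem exists_polyProj_eq {m : ℕ} (V : Set (E m)) (r : ℕ) (g : E m → E m) :
    ∃ P, polyProj V r g = polyField P ∧ (∀ c, (P c).totalDegree ≤ r) ∧
      (P = 0 ∨ IsPolyProj V r g P) := by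
  unfold polyProj
  split_ifs with h
  · exact ⟨_, rfl, fun c => (h.choose_spec c).1, Or.inr h.choose_spec⟩
  · refine ⟨0, ?_, fun c => by simp, Or.inl rfl⟩
    ext x c
    simp [polyField, polyFun]

/-- Pythagoras for u = (u − v) + v. -/
theorem integral_sq_le_of_orthogonal {α : Type*} [MeasurableSpace α] {μ : Measure α} {u v : α → ℝ}
    (hu : MemLp u 2 μ) (hv : MemLp v 2 μ) (h : ∫ x, (u x - v x) * v x ∂μ = 0) :
    ∫ x, v x ^ 2 ∂μ ≤ ∫ x, u x ^ 2 ∂μ := by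
  have hd := hu.sub hv
  have h1 : ∫ x, u x ^ 2 ∂μ = ∫ x, ((u x - v x) ^ 2 + 2 * ((u x - v x) * v x) + v x ^ 2) ∂μ :=
    integral_congr_ae (ae_of_all _ fun x => by ring)
  have i1 : Integrable (fun x => (u x - v x) ^ 2) μ := hd.integrable_sq
  have i2 : Integrable (fun x => 2 * ((u x - v x) * v x)) μ := (hd.integrable_mul hv).const_mul 2
  have i12 : Integrable (fun x => (u x - v x) ^ 2 + 2 * ((u x - v x) * v x)) μ := i1.add i2
  rw [h1, integral_add i12 hv.integrable_sq, integral_add i1 i2, integral_const_mul, h]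
  have : 0 ≤ ∫ x, (u x - v x) ^ 2 ∂μ := integral_nonneg fun x => sq_nonneg _
  linarith

/-- The projection, multiplied by a constant matrix, is stable in `L²`. -/
theorem exists_matAct_polyProj {m : ℕ} {V : Set (E m)} (hV : Bornology.IsBounded V) (r : ℕ)
    {g : E m → E m} (hg : MemLp g 2 (volume.restrict V)) (A : Matrix (Fin m) (Fin m) ℝ) :
    ∃ Q : Fin m → MvPolynomial (Fin m) ℝ, (∀ c, (Q c).totalDegree ≤ r) ∧
      (∀ x, matAct A (polyProj V r g x) = polyField Q x) ∧
      ∫ x in V, ‖polyField Q x‖ ^ 2 ≤ ∫ x in V, ‖matAct A (g x)‖ ^ 2 := by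
  obtain ⟨P, hP, hdeg, hproj⟩ := exists_polyProj_eq V r g
  set Q : Fin m → MvPolynomial (Fin m) ℝ := fun c => ∑ j, MvPolynomial.C (A c j) * P j with hQ
  have hQdeg : ∀ c, (Q c).totalDegree ≤ r := fun c => by
    refine MvPolynomial.totalDegree_finsetSum_le fun j _ => ?_
    refine (MvPolynomial.totalDegree_mul _ _).trans ?_
    rw [MvPolynomial.totalDegree_C, zero_add]
    exact hdeg j
  have hQfun : ∀ c x, polyFun (Q c) x = ∑ j, A c j * polyFun (P j) x := fun c x => by
    simp [polyFun, hQ]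
  refine ⟨Q, hQdeg, fun x => ?_, ?_⟩
  · ext c
    rw [hP, matAct_apply]
    simp [polyField, hQfun]
  have hgc : ∀ c, MemLp (fun x => g x c) 2 (volume.restrict V) := fun c =>
    (EuclideanSpace.proj (𝕜 := ℝ) c).comp_memLp' hg
  have hAc : ∀ c, MemLp (fun x => matAct A (g x) c) 2 (volume.restrict V) := fun c => by
    simp only [matAct_apply]
    exact memLp_finsetSum _ fun j _ => (hgc j).const_mul _
  have hpf : ∀ R : MvPolynomial (Fin m) ℝ, MemLp (polyFun R) 2 (volume.restrict V) := fun R =>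
    memLp_of_continuous hV (continuous_polyFun R) 2
  have hfield : ∀ x c, polyField Q x c = polyFun (Q c) x := fun x c => rfl
  simp only [EuclideanSpace.norm_sq_eq, Real.norm_eq_abs, sq_abs, hfield]
  rw [integral_finsetSum _ fun c _ => (hpf (Q c)).integrable_sq,
    integral_finsetSum _ fun c _ => (hAc c).integrable_sq]
  refine Finset.sum_le_sum fun c _ => ?_
  rcases hproj with h0 | hproj
  · have hz : ∀ x, polyFun (Q c) x ^ 2 = 0 := fun x => by
      rw [hQfun]
      simp [h0, polyFun]
    rw [integral_eq_zero_of_ae (ae_of_all _ hz)]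
    exact integral_nonneg fun x => sq_nonneg _
  -- A constant matrix commutes with the componentwise projection: the error of row c is a
  -- combination of the errors g_j − P_j, each orthogonal to `Q c`.
  refine integral_sq_le_of_orthogonal (hAc c) (hpf (Q c)) ?_
  have : ∀ x, (matAct A (g x) c - polyFun (Q c) x) * polyFun (Q c) x =
      ∑ j, A c j * ((g x j - polyFun (P j) x) * polyFun (Q c) x) := fun x => by
    rw [matAct_apply, hQfun, ← Finset.sum_sub_distrib, Finset.sum_mul]
    exact Finset.sum_congr rfl fun j _ => by ring
  simp only [this]
  rw [integral_finsetSum]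
  · refine Finset.sum_eq_zero fun j _ => ?_
    rw [integral_const_mul, (hproj j).2 _ (hQdeg c), mul_zero]
  · exact fun j _ => (((hgc j).sub (hpf (P j))).integrable_mul (hpf (Q c))).const_mul _

/-! ### Fluxes on the faces of an element -/

namespace Discretization

variable {d N : ℕ} {G : FractureNetwork d N} {c : Coefficients G} (M : Discretization G c)

theorem coeff_posDef (hd : d ≠ 0) (k : Fin N) (i : Fin (M.numElem k)) : (M.coeff k i).PosDef := by
  obtain ⟨x, hx⟩ := M.elem_nonempty hd k i
  obtain ⟨l, hl, hlk⟩ := c.aperture_lower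
  have hx' := M.elem_subset k i hx
  rw [← M.coeff_eq k i x hx]
  exact (c.perm_posDef k x hx').smul (hl.trans (hlk k x hx'))

theorem elemPenalty_pos (hd : d = 2 ∨ d = 3) (k : Fin N) (i : Fin (M.numElem k)) :
    0 < M.elemPenalty k i := by
  have h1 := sqrtNormSq_pos (by omega) (M.coeff_posDef (by omega) k i)
  have h2 := M.elemDiam_pos hd k i
  have h3 : (0 : ℝ) < (M.deg k i : ℝ) + (d : ℝ) - 1 := by
    have : (0 : ℝ) ≤ M.deg k i := by positivity
    obtain rfl | rfl := hd <;> norm_num <;> linarith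
  unfold elemPenalty
  positivity

/-- The fluxes on the faces of an element are controlled by the energy in disjoint parts of it. -/
theorem exists_face_energy (hd : d = 2 ∨ d = 3) {ρ : ℝ} (hρ : 0 < ρ) (hM : M.PolytopicRegular ρ)
    (q : NetFun d N) (k : Fin N) (i : Fin (M.numElem k)) :
    ∃ w : M.FaceLabel k → ℝ, (∀ a, 0 ≤ w a) ∧
      (∀ s : Finset (M.FaceLabel k), ∑ a ∈ s, w a ≤
        ∫ x in M.elem k i, ‖matAct (matSqrt (M.coeff k i)) (M.grad q k i x)‖ ^ 2) ∧
      ∀ a, ∀ e ⊆ M.faceSet k i a, IntegrableOn (fun x => ‖M.flux q k i x‖ ^ 2) e μHE[d - 2] ∧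
        ∫ x in e, ‖M.flux q k i x‖ ^ 2 ∂μHE[d - 2] ≤ 8 * ρ * M.elemPenalty k i * w a := by
  classical
  have hd0 : d ≠ 0 := by omega
  obtain ⟨S, hS, hSd⟩ := hM k i
  set K := M.coeff k i with hK
  have hKp := (M.coeff_posDef hd0 k i).posSemidef
  obtain ⟨Q, hQdeg, hQ, hQle⟩ := exists_matAct_polyProj (M.isBounded_elem k i) (M.deg k i)
    (memLp_weakGrad (M.elem k i) (q k)) (matSqrt K)
  have hQc : Continuous (polyField Q) := continuous_polyField Q
  have hQi : ∀ V : Set (E (d - 1)), Bornology.IsBounded V →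
      IntegrableOn (fun x => ‖polyField Q x‖ ^ 2) V := fun V hV =>
    memLp_one_iff_integrable.1 (memLp_of_continuous hV (by fun_prop) 1)
  have hflux : ∀ x, ‖M.flux q k i x‖ ^ 2 ≤ sqrtNormSq K * ‖polyField Q x‖ ^ 2 := fun x => by
    rw [← hQ]; exact norm_matAct_sq_le hKp _
  have hfluxc : Continuous (M.flux q k i) := by
    obtain ⟨P, hP, -⟩ := exists_polyProj_eq (M.elem k i) (M.deg k i) (M.grad q k i)
    have := continuous_polyField P
    unfold flux matAct
    rw [hP]
    fun_prop
  have hSb : ∀ a, Bornology.IsBounded (openSimplex (S a)) := fun a =>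
    (isBounded_convexHull.2 (finite_range _).isBounded).subset interior_subset
  -- Here `Q` represents K^{1/2}Π∇q, and the weight of a face is its energy in the simplex inscribed
  -- at that face. These simplices are disjoint, so any sum of weights is at most the energy on the
  -- element, with no factor counting faces.
  refine ⟨fun a => if M.IsFace k i a then ∫ x in openSimplex (S a), ‖polyField Q x‖ ^ 2 else 0,
    fun a => ?_, fun s => ?_, fun a e he => ?_⟩
  · beta_reduce
    split_ifs
    · exact integral_nonneg fun x => sq_nonneg _
    · exact le_rfl
  · refine le_trans ?_ hQle
    rw [← Finset.sum_filter, ← integral_biUnion_finset]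
    · refine setIntegral_mono_set (hQi _ (M.isBounded_elem k i))
        (ae_of_all _ fun x => sq_nonneg _) (LE.le.eventuallyLE ?_)
      exact iUnion₂_subset fun a ha => (hS a (Finset.mem_filter.1 ha).2).2.1
    · exact fun a _ => isOpen_interior.measurableSet
    · intro a ha b hb hab
      exact hSd a b (Finset.mem_filter.1 ha).2 (Finset.mem_filter.1 hb).2 hab
    · exact fun a _ => hQi _ (hSb a)
  · beta_reduce
    by_cases hf : M.IsFace k i a
    · rw [if_pos hf]
      obtain ⟨hai, hsub, heq, hle⟩ := hS a hf
      obtain ⟨Kc, hKc, hKcl, hKd, hKs⟩ := M.exists_convex_faceSet_subset k i a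
      obtain ⟨j, hj⟩ := exists_facet hd (M.isOpen_elem k i) (M.convex_elem k i) hKc hKcl hKd hai
        hsub heq hKs hf
      have hh := M.elemDiam_pos hd k i
      rw [hj] at hle he
      set C : ℝ := 8 * ρ * (((M.deg k i : ℝ) + 1) * ((M.deg k i : ℝ) + d - 1) / M.elemDiam k i)
      have hpen : 8 * ρ * M.elemPenalty k i = sqrtNormSq K * C := by
        simp only [elemPenalty, C, hK]; ring
      have hK0 : 0 ≤ sqrtNormSq K := sq_nonneg _
      have hC0 : 0 ≤ C := by
        have := (M.elemPenalty_pos hd k i).le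
        have h2 := sqrtNormSq_pos (by omega) (M.coeff_posDef hd0 k i)
        refine nonneg_of_mul_nonneg_right (a := sqrtNormSq K) ?_ h2
        rw [← hpen]; positivity
      have hnorm : ∀ x, ENNReal.ofReal (‖polyField Q x‖ ^ 2) =
          ∑ c, ENNReal.ofReal (polyFun (Q c) x ^ 2) := fun x => by
        rw [EuclideanSpace.norm_sq_eq, ENNReal.ofReal_sum_of_nonneg fun _ _ => sq_nonneg _]
        simp [polyField]
      have hmeas : ∀ c, Measurable fun x => ENNReal.ofReal (polyFun (Q c) x ^ 2) := fun c => by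
        have := continuous_polyFun (Q c)
        fun_prop
      have hlin : ∫⁻ x in e, ENNReal.ofReal (‖M.flux q k i x‖ ^ 2) ∂μHE[d - 2] ≤
          ENNReal.ofReal (8 * ρ * M.elemPenalty k i *
            ∫ x in openSimplex (S a), ‖polyField Q x‖ ^ 2) := by
        calc _ ≤ ∫⁻ x in convexHull ℝ (S a '' {j}ᶜ),
              ENNReal.ofReal (sqrtNormSq K) * ∑ c, ENNReal.ofReal (polyFun (Q c) x ^ 2)
                ∂μHE[d - 2] := by
              refine lintegral_mono' (Measure.restrict_mono he le_rfl) fun x => ?_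
              rw [← hnorm, ← ENNReal.ofReal_mul hK0]
              exact ENNReal.ofReal_le_ofReal (hflux x)
          _ = ENNReal.ofReal (sqrtNormSq K) * ∑ c, ∫⁻ x in convexHull ℝ (S a '' {j}ᶜ),
                ENNReal.ofReal (polyFun (Q c) x ^ 2) ∂μHE[d - 2] := by
              rw [lintegral_const_mul' _ _ ENNReal.ofReal_ne_top,
                lintegral_finsetSum _ fun c _ => hmeas c]
          _ ≤ ENNReal.ofReal (sqrtNormSq K) * ∑ c, ENNReal.ofReal C *
                ∫⁻ x in openSimplex (S a), ENNReal.ofReal (polyFun (Q c) x ^ 2) := by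
              gcongr with c
              exact lintegral_face_le hd hai j (Q c) (hQdeg c) hρ hh hle
          _ = _ := by
              rw [← Finset.mul_sum, ← lintegral_finsetSum _ fun c _ => hmeas c, hpen, mul_assoc,
                ENNReal.ofReal_mul hK0, ENNReal.ofReal_mul hC0,
                ofReal_integral_eq_lintegral_ofReal (hQi _ (hSb a))
                  (ae_of_all _ fun x => sq_nonneg _)]
              simp only [hnorm]
      have hm : AEStronglyMeasurable (fun x => ‖M.flux q k i x‖ ^ 2)
          ((μHE[d - 2] : Measure (E (d - 1))).restrict e) :=
        (by fun_prop : Continuous fun x => ‖M.flux q k i x‖ ^ 2).aestronglyMeasurable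
      have hw0 : 0 ≤ 8 * ρ * M.elemPenalty k i *
          ∫ x in openSimplex (S a), ‖polyField Q x‖ ^ 2 := by
        have := M.elemPenalty_pos hd k i
        have : 0 ≤ ∫ x in openSimplex (S a), ‖polyField Q x‖ ^ 2 :=
          integral_nonneg fun x => sq_nonneg _
        positivity
      refine ⟨⟨hm, ?_⟩, ?_⟩
      · rw [hasFiniteIntegral_iff_ofReal (ae_of_all _ fun x => sq_nonneg _)]
        exact hlin.trans_lt ENNReal.ofReal_lt_top
      · rw [integral_eq_lintegral_of_nonneg_ae (ae_of_all _ fun x => sq_nonneg _) hm]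
        exact ENNReal.toReal_le_of_le_ofReal hw0 hlin
    -- A label that is not an actual face carries only null sets, so weight 0 suffices.
    · have h0 : μHE[d - 2] e = 0 :=
        le_antisymm ((measure_mono he).trans (not_lt.1 hf)) zero_le
      rw [if_neg hf, IntegrableOn, Measure.restrict_eq_zero.2 h0]
      simp

end Discretization

/-! ### Young's inequality -/

theorem mul_le_young {s : ℝ} (hs : 0 < s) (x y : ℝ) : x * y ≤ s * x ^ 2 + s⁻¹ * y ^ 2 := by
  have h1 : 0 ≤ s⁻¹ * (s * x - y) ^ 2 := by positivity
  have h2 : s⁻¹ * (s * x - y) ^ 2 = s * x ^ 2 - 2 * (x * y) + s⁻¹ * y ^ 2 := by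
    field_simp
    ring
  have h3 : 0 ≤ s * x ^ 2 := by positivity
  have h4 : 0 ≤ s⁻¹ * y ^ 2 := by positivity
  linarith

theorem abs_inner_le_young {F : Type*} [NormedAddCommGroup F] [InnerProductSpace ℝ F] {s : ℝ}
    (hs : 0 < s) (u v : F) : |⟪u, v⟫| ≤ s * ‖u‖ ^ 2 + s⁻¹ * ‖v‖ ^ 2 :=
  (abs_real_inner_le_norm u v).trans (mul_le_young hs _ _)

theorem half_add_mul_le_young {s : ℝ} (hs : 0 < s) (a b y : ℝ) :
    (a + b) / 2 * y ≤ s * (a ^ 2 + b ^ 2) + s⁻¹ * y ^ 2 := by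
  refine (mul_le_young hs _ _).trans ?_
  have : ((a + b) / 2) ^ 2 ≤ a ^ 2 + b ^ 2 := by nlinarith [sq_nonneg (a - b), sq_nonneg a, sq_nonneg b]
  gcongr

/-- The optimal choice is t = b/a. Adding ε to both numbers keeps t positive and finite when a or b
vanishes; then ε → 0. -/
theorem le_of_forall_young {X A a b : ℝ} (ha : 0 ≤ a) (hb : 0 ≤ b) (hA : 0 ≤ A)
    (h : ∀ t : ℝ, 0 < t → X ≤ A * (t * a ^ 2 + t⁻¹ * b ^ 2)) : X ≤ 2 * A * b * a := by
  have hε : ∀ ε : ℝ, 0 < ε → X ≤ 2 * A * (b + ε) * (a + ε) := by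
    intro ε hε
    have ha' : 0 < a + ε := by linarith
    have hb' : 0 < b + ε := by linarith
    refine (h ((b + ε) / (a + ε)) (by positivity)).trans ?_
    have h1 : (b + ε) / (a + ε) * a ^ 2 ≤ (b + ε) * (a + ε) := by
      calc _ ≤ (b + ε) / (a + ε) * (a + ε) ^ 2 := by gcongr; linarith
        _ = _ := by field_simp
    have h2 : ((b + ε) / (a + ε))⁻¹ * b ^ 2 ≤ (b + ε) * (a + ε) := by
      calc _ ≤ ((b + ε) / (a + ε))⁻¹ * (b + ε) ^ 2 := by gcongr; linarith
        _ = _ := by field_simp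
    nlinarith
  have hlim : Tendsto (fun ε : ℝ => 2 * A * (b + ε) * (a + ε)) (𝓝[>] 0) (𝓝 (2 * A * b * a)) := by
    have : Continuous fun ε : ℝ => 2 * A * (b + ε) * (a + ε) := by fun_prop
    simpa using (this.tendsto 0).mono_left nhdsWithin_le_nhds
  exact ge_of_tendsto hlim (eventually_mem_nhdsWithin.mono fun ε h => hε ε h)

theorem abs_integral_inner_le_young {α F : Type*} [MeasurableSpace α] {μ : Measure α}
    [NormedAddCommGroup F] [InnerProductSpace ℝ F] {u v : α → F} (hu : MemLp u 2 μ)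
    (hv : MemLp v 2 μ) {t : ℝ} (ht : 0 < t) :
    |∫ x, ⟪u x, v x⟫ ∂μ| ≤ t * ∫ x, ⟪u x, u x⟫ ∂μ + t⁻¹ * ∫ x, ⟪v x, v x⟫ ∂μ := by
  have hu2 := hu.norm.integrable_sq
  have hv2 := hv.norm.integrable_sq
  simp only [real_inner_self_eq_norm_sq]
  rw [← integral_const_mul, ← integral_const_mul,
    ← integral_add (hu2.const_mul t) (hv2.const_mul t⁻¹), ← Real.norm_eq_abs]
  exact norm_integral_le_of_norm_le ((hu2.const_mul t).add (hv2.const_mul t⁻¹))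
    (ae_of_all _ fun x => abs_inner_le_young ht _ _)

/-- An upper bound is all that the estimate of the normal fluxes on the intersection requires, and
the default normal 0 satisfies it too. -/
theorem norm_outwardNormal_le {m : ℕ} (V e : Set (E m)) : ‖outwardNormal V e‖ ≤ 1 := by
  unfold outwardNormal
  split_ifs with h
  · exact h.choose_spec.1.le
  · simp

theorem memLp_trace {m : ℕ} (V e : Set (E m)) (u : E m → ℝ) :
    MemLp (trace V e u) 2 (μHE[m - 1].restrict e) := by
  unfold trace
  split_ifs with h
  · exact h.choose_spec.1
  · exact MemLp.zero

/-! ### Sets on the intersection -/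

namespace FractureMesh

variable {d N : ℕ} {G : FractureNetwork d N} (M : FractureMesh G)

theorem interEdge_subset_range (T : ∀ k, Fin (M.numElem k)) (k : Fin N) :
    M.interEdge T ⊆ range (G.emb k) :=
  (iInter_subset _ k).trans (image_subset_range _ _)

/-- An intersection edge is shared by N fractures, so its integrals are taken in ℝᵈ while the flux
bounds live in the coordinates of each fracture. The isometry `G.emb k` identifies the two measures.
-/
theorem restrict_interEdge (T : ∀ k, Fin (M.numElem k)) (k : Fin N) :
    (μHE[d - 2] : Measure (E d)).restrict (M.interEdge T) =
      Measure.map (G.emb k) (μHE[d - 2].restrict (M.interEdgeOn T k)) := by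
  have hemb := (G.emb k).isometry.isClosedEmbedding.measurableEmbedding
  rw [interEdgeOn, ← hemb.restrict_map, (G.emb k).isometry.map_euclideanHausdorffMeasure,
    Measure.restrict_restrict_of_subset (M.interEdge_subset_range T k)]

theorem invFun_emb (k : Fin N) (x : E (d - 1)) : Function.invFun (G.emb k) (G.emb k x) = x :=
  Function.leftInverse_invFun (G.emb k).injective x

theorem memLp_interEdge (T : ∀ k, Fin (M.numElem k)) (k : Fin N) {u : E (d - 1) → ℝ}
    (hu : MemLp u 2 (μHE[d - 2].restrict (M.interEdgeOn T k))) :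
    MemLp (fun y => u (Function.invFun (G.emb k) y)) 2 (μHE[d - 2].restrict (M.interEdge T)) := by
  have hemb := (G.emb k).isometry.isClosedEmbedding.measurableEmbedding
  rw [M.restrict_interEdge T k, hemb.memLp_map_measure_iff]
  simpa [Function.comp_def, invFun_emb] using hu

theorem integrable_interEdge (T : ∀ k, Fin (M.numElem k)) (k : Fin N) {u : E (d - 1) → ℝ}
    (hu : IntegrableOn u (M.interEdgeOn T k) μHE[d - 2]) :
    IntegrableOn (fun y => u (Function.invFun (G.emb k) y)) (M.interEdge T) μHE[d - 2] := by
  have hemb := (G.emb k).isometry.isClosedEmbedding.measurableEmbedding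
  rw [IntegrableOn, M.restrict_interEdge T k, hemb.integrable_map_iff]
  simpa [Function.comp_def, invFun_emb, IntegrableOn] using hu

theorem integral_interEdge (T : ∀ k, Fin (M.numElem k)) (k : Fin N) (u : E (d - 1) → ℝ) :
    ∫ y in M.interEdge T, u (Function.invFun (G.emb k) y) ∂μHE[d - 2] =
      ∫ x in M.interEdgeOn T k, u x ∂μHE[d - 2] := by
  have hemb := (G.emb k).isometry.isClosedEmbedding.measurableEmbedding
  rw [M.restrict_interEdge T k, hemb.integral_map]
  simp [invFun_emb]

end FractureMesh

namespace Discretization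

variable {d N : ℕ} {G : FractureNetwork d N} {c : Coefficients G} (M : Discretization G c)

/-! ### The parts of the form -/

/-- The diffusion part of the form. -/
noncomputable def energyForm (p q : NetFun d N) : ℝ :=
  ∑ k, ∑ i, ∫ x in M.elem k i, ⟪matAct (M.coeff k i) (M.grad p k i x), M.grad q k i x⟫

/-- The consistency part of the form. -/
noncomputable def consistencyForm (p q : NetFun d N) : ℝ :=
  M.intInterior (fun k i j x => ⟪M.avgFlux p k i j x, M.jump q k i j x⟫)
    + M.intDirichlet (fun b x => ⟪M.avgFluxBdry p b x, M.jumpBdry q b x⟫)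
    + M.intInter (fun T k l y => M.avgFluxInter p T k l y) (fun T k l y => M.jumpInter q T k l y)

/-- The penalty part of the form. -/
noncomputable def jumpForm (σ₀ : ℝ) (p q : NetFun d N) : ℝ :=
  M.intInterior (fun k i j x => M.sigmaInterior σ₀ k i j * ⟪M.jump p k i j x, M.jump q k i j x⟫)
    + M.intDirichlet (fun b x => M.sigmaBdry σ₀ b * ⟪M.jumpBdry p b x, M.jumpBdry q b x⟫)
    + M.intInter (fun T k l y => M.sigmaInter σ₀ T * M.jumpInter p T k l y)
        (fun T k l y => M.jumpInter q T k l y)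

theorem form_eq (σ₀ : ℝ) (p q : NetFun d N) : M.form σ₀ p q =
    M.energyForm p q - M.consistencyForm p q - M.consistencyForm q p + M.jumpForm σ₀ p q := rfl

theorem energyForm_eq (hd : d ≠ 0) (p q : NetFun d N) : M.energyForm p q =
    ∑ k, ∑ i, ∫ x in M.elem k i, ⟪matAct (matSqrt (M.coeff k i)) (M.grad p k i x),
      matAct (matSqrt (M.coeff k i)) (M.grad q k i x)⟫ := by
  unfold energyForm
  simp only [inner_matAct (M.coeff_posDef hd _ _).posSemidef]

theorem memLp_matAct_grad (q : NetFun d N) (k : Fin N) (i : Fin (M.numElem k))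
    (A : Matrix (Fin (d - 1)) (Fin (d - 1)) ℝ) :
    MemLp (fun x => matAct A (M.grad q k i x)) 2 (volume.restrict (M.elem k i)) :=
  (Matrix.toEuclideanCLM (n := Fin (d - 1)) (𝕜 := ℝ) A).comp_memLp' (memLp_weakGrad _ _)

theorem energyForm_self_nonneg (hd : d ≠ 0) (q : NetFun d N) : 0 ≤ M.energyForm q q := by
  rw [M.energyForm_eq hd]
  exact Finset.sum_nonneg fun k _ => Finset.sum_nonneg fun i _ =>
    integral_nonneg fun x => real_inner_self_nonneg

theorem abs_energyForm_le (hd : d ≠ 0) (p q : NetFun d N) {t : ℝ} (ht : 0 < t) :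
    |M.energyForm p q| ≤ t * M.energyForm p p + t⁻¹ * M.energyForm q q := by
  simp only [M.energyForm_eq hd, Finset.mul_sum, ← Finset.sum_add_distrib]
  refine (Finset.abs_sum_le_sum_abs _ _).trans (Finset.sum_le_sum fun k _ =>
    (Finset.abs_sum_le_sum_abs _ _).trans (Finset.sum_le_sum fun i _ => ?_))
  exact abs_integral_inner_le_young (M.memLp_matAct_grad p k i _) (M.memLp_matAct_grad q k i _) ht

theorem memLp_jump (q : NetFun d N) (k : Fin N) (i j : Fin (M.numElem k)) :
    MemLp (M.jump q k i j) 2 (μHE[d - 2].restrict (M.interiorEdge k i j)) := by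
  have h : ∀ (l : Fin (M.numElem k)) (ν : E (d - 1)),
      MemLp (fun x => M.tr q k l (M.interiorEdge k i j) x • ν) 2
        (μHE[d - 2].restrict (M.interiorEdge k i j)) := fun l ν =>
    (ContinuousLinearMap.toSpanSingleton ℝ ν).comp_memLp' (memLp_trace _ _ _)
  exact (h i _).add (h j _)

theorem memLp_jumpBdry (q : NetFun d N) (b : Fin M.numBdry) :
    MemLp (M.jumpBdry q b) 2 (μHE[d - 2].restrict (M.bdryEdge b)) :=
  (ContinuousLinearMap.toSpanSingleton ℝ (outwardNormal
    (M.elem (M.bdryOwner b).1 (M.bdryOwner b).2) (M.bdryEdge b))).comp_memLp' (memLp_trace _ _ _)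

theorem memLp_jumpInter (q : NetFun d N) (T : ∀ k, Fin (M.numElem k)) (k l : Fin N) :
    MemLp (M.jumpInter q T k l) 2 (μHE[d - 2].restrict (M.interEdge T)) :=
  (M.memLp_interEdge T k (memLp_trace _ _ _)).sub (M.memLp_interEdge T l (memLp_trace _ _ _))

theorem elemPenalty_le_sigmaInter {σ₀ : ℝ} (hσ : 0 < σ₀) (T : ∀ k, Fin (M.numElem k)) (k : Fin N) :
    σ₀ * M.elemPenalty k (T k) ≤ M.sigmaInter σ₀ T :=
  mul_le_mul_of_nonneg_left (le_ciSup (f := fun k => M.elemPenalty k (T k))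
    (Set.finite_range _).bddAbove k) hσ.le

theorem sigmaInterior_pos (hd : d = 2 ∨ d = 3) {σ₀ : ℝ} (hσ : 0 < σ₀) (k : Fin N)
    (i j : Fin (M.numElem k)) : 0 < M.sigmaInterior σ₀ k i j :=
  mul_pos hσ ((M.elemPenalty_pos hd k i).trans_le (le_max_left _ _))

theorem sigmaBdry_pos (hd : d = 2 ∨ d = 3) {σ₀ : ℝ} (hσ : 0 < σ₀) (b : Fin M.numBdry) :
    0 < M.sigmaBdry σ₀ b :=
  mul_pos hσ (M.elemPenalty_pos hd _ _)

theorem sigmaInter_pos (hd : d = 2 ∨ d = 3) (hN : 2 ≤ N) {σ₀ : ℝ} (hσ : 0 < σ₀)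
    (T : ∀ k, Fin (M.numElem k)) : 0 < M.sigmaInter σ₀ T :=
  (mul_pos hσ (M.elemPenalty_pos hd ⟨0, by omega⟩ _)).trans_le
    (M.elemPenalty_le_sigmaInter hσ T ⟨0, by omega⟩)

theorem jumpForm_self_nonneg (hd : d = 2 ∨ d = 3) (hN : 2 ≤ N) {σ₀ : ℝ} (hσ : 0 < σ₀)
    (q : NetFun d N) : 0 ≤ M.jumpForm σ₀ q q := by
  unfold jumpForm intInterior intDirichlet intInter
  refine add_nonneg (add_nonneg ?_ ?_) ?_
  · exact Finset.sum_nonneg fun k _ => Finset.sum_nonneg fun i _ => Finset.sum_nonneg fun j _ =>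
      integral_nonneg fun x =>
        mul_nonneg (M.sigmaInterior_pos hd hσ k i j).le real_inner_self_nonneg
  · exact Finset.sum_nonneg fun b _ => integral_nonneg fun x =>
      mul_nonneg (M.sigmaBdry_pos hd hσ b).le real_inner_self_nonneg
  · refine Finset.sum_nonneg fun T _ => integral_nonneg fun y => Finset.sum_nonneg fun k _ =>
      Finset.sum_nonneg fun l _ => ?_
    rw [mul_assoc]
    exact mul_nonneg (M.sigmaInter_pos hd hN hσ T).le (mul_self_nonneg _)

/-- Both summands are nonnegative, so `Real.sqrt` is not truncated and squaring undoes it. -/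
theorem dgNorm_sq (hd : d = 2 ∨ d = 3) (hN : 2 ≤ N) {σ₀ : ℝ} (hσ : 0 < σ₀) (q : NetFun d N) :
    M.dgNorm σ₀ q ^ 2 = M.energyForm q q + M.jumpForm σ₀ q q := by
  have h : M.dgNorm σ₀ q = Real.sqrt (M.energyForm q q + M.jumpForm σ₀ q q) := by
    rw [M.energyForm_eq (by omega)]
    unfold dgNorm jumpForm
    simp only [real_inner_self_eq_norm_sq, ← add_assoc]
  rw [h, Real.sq_sqrt (add_nonneg (M.energyForm_self_nonneg (by omega) q)
    (M.jumpForm_self_nonneg hd hN hσ q))]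

theorem integrable_sum_jumpInter (σ : ℝ) (p q : NetFun d N) (T : ∀ k, Fin (M.numElem k)) :
    IntegrableOn (fun y => ∑ k, ∑ l ∈ Finset.Ioi k,
      σ * M.jumpInter p T k l y * M.jumpInter q T k l y) (M.interEdge T) μHE[d - 2] := by
  refine integrable_finsetSum _ fun k _ => integrable_finsetSum _ fun l _ => ?_
  simp only [mul_assoc]
  exact ((M.memLp_jumpInter p T k l).integrable_mul (M.memLp_jumpInter q T k l)).const_mul _

theorem abs_jumpForm_le (hd : d = 2 ∨ d = 3) (hN : 2 ≤ N) {σ₀ : ℝ} (hσ : 0 < σ₀)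
    (p q : NetFun d N) {t : ℝ} (ht : 0 < t) :
    |M.jumpForm σ₀ p q| ≤ t * M.jumpForm σ₀ p p + t⁻¹ * M.jumpForm σ₀ q q := by
  have hI : |M.intInterior fun k i j x =>
        M.sigmaInterior σ₀ k i j * ⟪M.jump p k i j x, M.jump q k i j x⟫| ≤
      t * M.intInterior (fun k i j x =>
        M.sigmaInterior σ₀ k i j * ⟪M.jump p k i j x, M.jump p k i j x⟫) +
      t⁻¹ * M.intInterior (fun k i j x =>
        M.sigmaInterior σ₀ k i j * ⟪M.jump q k i j x, M.jump q k i j x⟫) := by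
    simp only [intInterior, Finset.mul_sum, ← Finset.sum_add_distrib]
    refine (Finset.abs_sum_le_sum_abs _ _).trans (Finset.sum_le_sum fun k _ =>
      (Finset.abs_sum_le_sum_abs _ _).trans (Finset.sum_le_sum fun i _ =>
      (Finset.abs_sum_le_sum_abs _ _).trans (Finset.sum_le_sum fun j _ => ?_)))
    have hs := M.sigmaInterior_pos hd hσ k i j
    simp only [integral_const_mul]
    rw [abs_mul, abs_of_pos hs, mul_left_comm t, mul_left_comm t⁻¹, ← mul_add]
    exact mul_le_mul_of_nonneg_left
      (abs_integral_inner_le_young (M.memLp_jump p k i j) (M.memLp_jump q k i j) ht) hs.le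
  have hD : |M.intDirichlet fun b x =>
        M.sigmaBdry σ₀ b * ⟪M.jumpBdry p b x, M.jumpBdry q b x⟫| ≤
      t * M.intDirichlet (fun b x => M.sigmaBdry σ₀ b * ⟪M.jumpBdry p b x, M.jumpBdry p b x⟫) +
      t⁻¹ * M.intDirichlet (fun b x =>
        M.sigmaBdry σ₀ b * ⟪M.jumpBdry q b x, M.jumpBdry q b x⟫) := by
    simp only [intDirichlet, Finset.mul_sum, ← Finset.sum_add_distrib]
    refine (Finset.abs_sum_le_sum_abs _ _).trans (Finset.sum_le_sum fun b _ => ?_)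
    have hs := M.sigmaBdry_pos hd hσ b
    simp only [integral_const_mul]
    rw [abs_mul, abs_of_pos hs, mul_left_comm t, mul_left_comm t⁻¹, ← mul_add]
    exact mul_le_mul_of_nonneg_left
      (abs_integral_inner_le_young (M.memLp_jumpBdry p b) (M.memLp_jumpBdry q b) ht) hs.le
  have hX : |M.intInter (fun T k l y => M.sigmaInter σ₀ T * M.jumpInter p T k l y)
        (fun T k l y => M.jumpInter q T k l y)| ≤
      t * M.intInter (fun T k l y => M.sigmaInter σ₀ T * M.jumpInter p T k l y)
        (fun T k l y => M.jumpInter p T k l y) +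
      t⁻¹ * M.intInter (fun T k l y => M.sigmaInter σ₀ T * M.jumpInter q T k l y)
        (fun T k l y => M.jumpInter q T k l y) := by
    simp only [intInter, Finset.mul_sum, ← Finset.sum_add_distrib]
    refine (Finset.abs_sum_le_sum_abs _ _).trans (Finset.sum_le_sum fun T _ => ?_)
    have hs := M.sigmaInter_pos hd hN hσ T
    have ip := (M.integrable_sum_jumpInter (M.sigmaInter σ₀ T) p p T).const_mul t
    have iq := (M.integrable_sum_jumpInter (M.sigmaInter σ₀ T) q q T).const_mul t⁻¹
    rw [← integral_const_mul, ← integral_const_mul, ← integral_add ip iq, ← Real.norm_eq_abs]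
    refine norm_integral_le_of_norm_le (ip.add iq) (ae_of_all _ fun y => ?_)
    simp only [Finset.mul_sum, ← Finset.sum_add_distrib, Real.norm_eq_abs]
    refine (Finset.abs_sum_le_sum_abs _ _).trans (Finset.sum_le_sum fun k _ =>
      (Finset.abs_sum_le_sum_abs _ _).trans (Finset.sum_le_sum fun l _ => ?_))
    have hy := mul_le_young ht |M.jumpInter p T k l y| |M.jumpInter q T k l y|
    rw [sq_abs, sq_abs] at hy
    rw [abs_mul, abs_mul, abs_of_pos hs]
    nlinarith [mul_le_mul_of_nonneg_left hy hs.le]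
  unfold jumpForm
  refine (abs_add_le _ _).trans ((add_le_add ((abs_add_le _ _).trans (add_le_add hI hD)) hX).trans ?_)
  apply le_of_eq
  ring

end Discretization

namespace Discretization

variable {d N : ℕ} {G : FractureNetwork d N} {c : Coefficients G} (M : Discretization G c)

/-! ### The consistency terms -/

/-- The numbers `w` bound the fluxes of `p` on the faces of all elements. -/
def IsFaceEnergy (B : ℝ) (p : NetFun d N)
    (w : ∀ k, Fin (M.numElem k) → M.FaceLabel k → ℝ) : Prop :=
  ∀ k i a, 0 ≤ w k i a ∧ ∀ e ⊆ M.faceSet k i a,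
    IntegrableOn (fun x => ‖M.flux p k i x‖ ^ 2) e μHE[d - 2] ∧
      ∫ x in e, ‖M.flux p k i x‖ ^ 2 ∂μHE[d - 2] ≤ B * M.elemPenalty k i * w k i a

/-- The penalty on an edge dominates σ₀ times that of each adjacent element, so dividing by it
cancels the factor `pen` of the inverse inequality. What remains involves neither h_F, nor k_F, nor
the coefficients. -/
theorem penalty_weight_le {B σ₀ σ t pen w I : ℝ} (hσ₀ : 0 < σ₀) (hσ : 0 < σ) (ht : 0 < t)
    (hB : 0 ≤ B) (hw : 0 ≤ w) (hpen : σ₀ * pen ≤ σ) (hI : I ≤ B * pen * w) :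
    t / σ * I ≤ t * (B / σ₀) * w := by
  calc t / σ * I ≤ t / σ * (B * pen * w) := by gcongr
    _ = t * (B / σ₀) * w * (σ₀ * pen / σ) := by field_simp
    _ ≤ t * (B / σ₀) * w * 1 := by
      gcongr
      exact (div_le_one hσ).2 hpen
    _ = _ := mul_one _

variable {M}

/-- Young's inequality with parameter t/σ: its reciprocal σ/t puts exactly the penalty weight on the
jump, while the fluxes from the two sides are bounded by the face weights. -/
theorem IsFaceEnergy.abs_interior_le (hd : d = 2 ∨ d = 3) {B : ℝ} (hB : 0 ≤ B) {p : NetFun d N}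
    {w : ∀ k, Fin (M.numElem k) → M.FaceLabel k → ℝ} (hw : M.IsFaceEnergy B p w) {σ₀ : ℝ}
    (hσ : 0 < σ₀) (q : NetFun d N) {t : ℝ} (ht : 0 < t) (k : Fin N) {i j : Fin (M.numElem k)}
    (hij : i ≠ j) :
    |∫ x in M.interiorEdge k i j, ⟪M.avgFlux p k i j x, M.jump q k i j x⟫ ∂μHE[d - 2]| ≤
      t * (B / σ₀) * (w k i (.interior j) + w k j (.interior i)) +
      t⁻¹ * ∫ x in M.interiorEdge k i j,
        M.sigmaInterior σ₀ k i j * ⟪M.jump q k i j x, M.jump q k i j x⟫ ∂μHE[d - 2] := by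
  have hs := M.sigmaInterior_pos hd hσ k i j
  set σ := M.sigmaInterior σ₀ k i j
  obtain ⟨hwi, hi⟩ := hw k i (.interior j)
  obtain ⟨hwj, hj⟩ := hw k j (.interior i)
  obtain ⟨ii, hi⟩ := hi (M.interiorEdge k i j) fun x hx => ⟨hij, subset_closure hx⟩
  obtain ⟨ij, hj⟩ := hj (M.interiorEdge k i j) fun x hx => ⟨hij.symm, subset_closure
    (by rwa [FractureMesh.interiorEdge, inter_comm (frontier (M.elem k j))])⟩
  have iJ : IntegrableOn (fun x => σ * ⟪M.jump q k i j x, M.jump q k i j x⟫)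
      (M.interiorEdge k i j) μHE[d - 2] := by
    simp only [real_inner_self_eq_norm_sq]
    exact (M.memLp_jump q k i j).norm.integrable_sq.const_mul _
  have hb : ∀ x, ‖⟪M.avgFlux p k i j x, M.jump q k i j x⟫‖ ≤
      t / σ * ‖M.flux p k i x‖ ^ 2 + t / σ * ‖M.flux p k j x‖ ^ 2 +
        t⁻¹ * (σ * ⟪M.jump q k i j x, M.jump q k i j x⟫) := fun x => by
    have h1 : ‖M.avgFlux p k i j x‖ ≤ (‖M.flux p k i x‖ + ‖M.flux p k j x‖) / 2 := by
      rw [avgFlux, norm_smul]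
      have := norm_add_le (M.flux p k i x) (M.flux p k j x)
      norm_num
      linarith
    refine (norm_inner_le_norm _ _).trans ((mul_le_mul_of_nonneg_right h1 (norm_nonneg _)).trans
      ((half_add_mul_le_young (div_pos ht hs) _ _ _).trans_eq ?_))
    rw [real_inner_self_eq_norm_sq, inv_div]
    ring
  have iF : IntegrableOn (fun x => t / σ * ‖M.flux p k i x‖ ^ 2 + t / σ * ‖M.flux p k j x‖ ^ 2)
      (M.interiorEdge k i j) μHE[d - 2] := (ii.const_mul (t / σ)).add (ij.const_mul (t / σ))
  have := norm_integral_le_of_norm_le (iF.add (iJ.const_mul t⁻¹)) (ae_of_all _ hb)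
  rw [Real.norm_eq_abs] at this
  refine this.trans ?_
  simp only [Pi.add_apply]
  rw [integral_add iF (iJ.const_mul t⁻¹), integral_add (ii.const_mul _) (ij.const_mul _),
    integral_const_mul, integral_const_mul, integral_const_mul, mul_add]
  refine add_le_add (add_le_add ?_ ?_) le_rfl
  · exact penalty_weight_le hσ hs ht hB hwi
      (mul_le_mul_of_nonneg_left (le_max_left _ _) hσ.le) hi
  · exact penalty_weight_le hσ hs ht hB hwj
      (mul_le_mul_of_nonneg_left (le_max_right _ _) hσ.le) hj

theorem IsFaceEnergy.abs_bdry_le (hd : d = 2 ∨ d = 3) {B : ℝ} (hB : 0 ≤ B) {p : NetFun d N}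
    {w : ∀ k, Fin (M.numElem k) → M.FaceLabel k → ℝ} (hw : M.IsFaceEnergy B p w) {σ₀ : ℝ}
    (hσ : 0 < σ₀) (q : NetFun d N) {t : ℝ} (ht : 0 < t) (b : Fin M.numBdry) :
    |∫ x in M.bdryEdge b, ⟪M.avgFluxBdry p b x, M.jumpBdry q b x⟫ ∂μHE[d - 2]| ≤
      t * (B / σ₀) * w (M.bdryOwner b).1 (M.bdryOwner b).2 (.boundary b) +
      t⁻¹ * ∫ x in M.bdryEdge b,
        M.sigmaBdry σ₀ b * ⟪M.jumpBdry q b x, M.jumpBdry q b x⟫ ∂μHE[d - 2] := by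
  have hs := M.sigmaBdry_pos hd hσ b
  set σ := M.sigmaBdry σ₀ b
  obtain ⟨hwi, hi⟩ := hw (M.bdryOwner b).1 (M.bdryOwner b).2 (.boundary b)
  obtain ⟨ii, hi⟩ := hi (M.bdryEdge b) fun x hx => ⟨rfl, hx⟩
  have iJ : IntegrableOn (fun x => σ * ⟪M.jumpBdry q b x, M.jumpBdry q b x⟫)
      (M.bdryEdge b) μHE[d - 2] := by
    simp only [real_inner_self_eq_norm_sq]
    exact (M.memLp_jumpBdry q b).norm.integrable_sq.const_mul _
  have hb : ∀ x, ‖⟪M.avgFluxBdry p b x, M.jumpBdry q b x⟫‖ ≤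
      t / σ * ‖M.flux p (M.bdryOwner b).1 (M.bdryOwner b).2 x‖ ^ 2 +
        t⁻¹ * (σ * ⟪M.jumpBdry q b x, M.jumpBdry q b x⟫) := fun x => by
    refine (abs_inner_le_young (div_pos ht hs) _ _).trans_eq ?_
    rw [real_inner_self_eq_norm_sq, inv_div, avgFluxBdry]
    ring
  have := norm_integral_le_of_norm_le ((ii.const_mul (t / σ)).add (iJ.const_mul t⁻¹))
    (ae_of_all _ hb)
  rw [Real.norm_eq_abs] at this
  refine this.trans ?_
  simp only [Pi.add_apply]
  rw [integral_add (ii.const_mul _) (iJ.const_mul t⁻¹), integral_const_mul, integral_const_mul]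
  refine add_le_add ?_ le_rfl
  exact penalty_weight_le hσ hs ht hB hwi le_rfl hi

theorem IsFaceEnergy.abs_inter_le (hd : d = 2 ∨ d = 3) (hN : 2 ≤ N) {B : ℝ} (hB : 0 ≤ B)
    {p : NetFun d N} {w : ∀ k, Fin (M.numElem k) → M.FaceLabel k → ℝ}
    (hw : M.IsFaceEnergy B p w) {σ₀ : ℝ} (hσ : 0 < σ₀) (q : NetFun d N) {t : ℝ} (ht : 0 < t)
    (T : ∀ k, Fin (M.numElem k)) :
    |∫ y in M.interEdge T, ∑ k, ∑ l ∈ Finset.Ioi k,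
        M.avgFluxInter p T k l y * M.jumpInter q T k l y ∂μHE[d - 2]| ≤
      t * (B / σ₀) * (2 * N * ∑ k, w k (T k) (.inter T)) +
      t⁻¹ * ∫ y in M.interEdge T, ∑ k, ∑ l ∈ Finset.Ioi k,
        M.sigmaInter σ₀ T * M.jumpInter q T k l y * M.jumpInter q T k l y ∂μHE[d - 2] := by
  have hs := M.sigmaInter_pos hd hN hσ T
  set σ := M.sigmaInter σ₀ T
  set F : Fin N → E d → ℝ := fun k y => ‖M.flux p k (T k) (Function.invFun (G.emb k) y)‖ ^ 2 with hF
  have hloc : ∀ k, IntegrableOn (F k) (M.interEdge T) μHE[d - 2] ∧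
      ∫ y in M.interEdge T, F k y ∂μHE[d - 2] ≤
        B * M.elemPenalty k (T k) * w k (T k) (.inter T) := fun k => by
    obtain ⟨i1, i2⟩ := (hw k (T k) (.inter T)).2 (M.interEdgeOn T k) fun x hx => ⟨rfl, hx⟩
    refine ⟨M.integrable_interEdge T k i1, ?_⟩
    rw [M.integral_interEdge T k fun x => ‖M.flux p k (T k) x‖ ^ 2]
    exact i2
  have hφ : ∀ k y, |M.normalFluxInter p T k y| ≤
      ‖M.flux p k (T k) (Function.invFun (G.emb k) y)‖ := fun k y =>
    (abs_real_inner_le_norm _ _).trans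
      (mul_le_of_le_one_right (norm_nonneg _) (norm_outwardNormal_le _ _))
  have hpair : ∀ y k l, |M.avgFluxInter p T k l y * M.jumpInter q T k l y| ≤
      t / σ * (F k y + F l y) +
        t⁻¹ * (σ * M.jumpInter q T k l y * M.jumpInter q T k l y) := fun y k l => by
    have h1 : |M.avgFluxInter p T k l y| ≤
        (‖M.flux p k (T k) (Function.invFun (G.emb k) y)‖ +
          ‖M.flux p l (T l) (Function.invFun (G.emb l) y)‖) / 2 := by
      -- Since N ≥ 2, the average over the intersection is no larger than an ordinary mean of two
      -- fluxes, and the same form of Young's inequality applies.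
      have h2 : (1 / (N : ℝ)) ≤ 1 / 2 :=
        one_div_le_one_div_of_le two_pos (by exact_mod_cast hN)
      rw [avgFluxInter, abs_mul, abs_of_nonneg (by positivity)]
      have h3 := (abs_sub (M.normalFluxInter p T k y) (M.normalFluxInter p T l y)).trans
        (add_le_add (hφ k y) (hφ l y))
      calc _ ≤ 1 / 2 * _ := mul_le_mul h2 h3 (abs_nonneg _) (by norm_num)
        _ = _ := by ring
    rw [abs_mul]
    refine (mul_le_mul_of_nonneg_right h1 (abs_nonneg _)).trans
      ((half_add_mul_le_young (div_pos ht hs) _ _ _).trans_eq ?_)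
    rw [sq_abs, inv_div]
    simp only [hF]
    ring
  have hF0 : ∀ k y, 0 ≤ F k y := fun k y => sq_nonneg _
  have hb : ∀ y, ‖∑ k, ∑ l ∈ Finset.Ioi k, M.avgFluxInter p T k l y * M.jumpInter q T k l y‖ ≤
      t / σ * (2 * N * ∑ k, F k y) + t⁻¹ * ∑ k, ∑ l ∈ Finset.Ioi k,
        σ * M.jumpInter q T k l y * M.jumpInter q T k l y := fun y => by
    rw [Real.norm_eq_abs]
    calc _ ≤ ∑ k, ∑ l ∈ Finset.Ioi k, (t / σ * (F k y + F l y) +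
            t⁻¹ * (σ * M.jumpInter q T k l y * M.jumpInter q T k l y)) :=
          (Finset.abs_sum_le_sum_abs _ _).trans (Finset.sum_le_sum fun k _ =>
            (Finset.abs_sum_le_sum_abs _ _).trans (Finset.sum_le_sum fun l _ => hpair y k l))
      _ = t / σ * (∑ k, ∑ l ∈ Finset.Ioi k, (F k y + F l y)) + t⁻¹ * ∑ k, ∑ l ∈ Finset.Ioi k,
            σ * M.jumpInter q T k l y * M.jumpInter q T k l y := by
          simp only [mul_add, Finset.sum_add_distrib, Finset.mul_sum]
      _ ≤ _ := by
          gcongr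
          -- Passing from pairs k < l to all pairs makes each F_k appear 2N times; this is the
          -- source of the factor 2N.
          calc _ ≤ ∑ k, ∑ l, (F k y + F l y) := Finset.sum_le_sum fun k _ =>
                Finset.sum_le_sum_of_subset_of_nonneg (Finset.subset_univ _)
                  fun l _ _ => add_nonneg (hF0 k y) (hF0 l y)
            _ = _ := by
                simp only [Finset.sum_add_distrib, Finset.sum_const, Finset.card_univ,
                  Fintype.card_fin, nsmul_eq_mul, ← Finset.mul_sum]
                ring
  have iF : IntegrableOn (fun y => t / σ * (2 * N * ∑ k, F k y)) (M.interEdge T) μHE[d - 2] :=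
    ((integrable_finsetSum _ fun k _ => (hloc k).1).const_mul _).const_mul _
  have iJ := (M.integrable_sum_jumpInter σ q q T).const_mul t⁻¹
  have := norm_integral_le_of_norm_le (iF.add iJ) (ae_of_all _ hb)
  rw [Real.norm_eq_abs] at this
  refine this.trans ?_
  simp only [Pi.add_apply]
  rw [integral_add iF iJ, integral_const_mul, integral_const_mul, integral_const_mul,
    integral_finsetSum _ fun k _ => (hloc k).1]
  refine add_le_add ?_ le_rfl
  calc _ = 2 * N * ∑ k, t / σ * ∫ y in M.interEdge T, F k y ∂μHE[d - 2] := by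
        rw [← Finset.mul_sum]; ring
    _ ≤ 2 * N * ∑ k, t * (B / σ₀) * w k (T k) (.inter T) := by
        refine mul_le_mul_of_nonneg_left (Finset.sum_le_sum fun k _ => ?_) (by positivity)
        exact penalty_weight_le hσ hs ht hB (hw k (T k) (.inter T)).1
          (M.elemPenalty_le_sigmaInter hσ T k) (hloc k).2
    _ = _ := by rw [← Finset.mul_sum]; ring

variable (M)

/-- The constant 3 + 2N counts how often the energy is spent: twice for interior edges, seen from
both sides, once for Dirichlet edges, and 2N times for the intersection. -/
theorem abs_consistencyForm_le (hd : d = 2 ∨ d = 3) (hN : 2 ≤ N) {ρ : ℝ} (hρ : 0 < ρ)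
    (hM : M.PolytopicRegular ρ) {σ₀ : ℝ} (hσ : 0 < σ₀) (p q : NetFun d N) {t : ℝ} (ht : 0 < t) :
    |M.consistencyForm p q| ≤ t * (8 * ρ * (3 + 2 * N) / σ₀) * M.energyForm p p +
      t⁻¹ * M.jumpForm σ₀ q q := by
  classical
  choose w hw0 hws hwe using fun k i => M.exists_face_energy hd hρ hM p k i
  have hw : M.IsFaceEnergy (8 * ρ) p w := fun k i a => ⟨hw0 k i a, hwe k i a⟩
  have hB : 0 ≤ 8 * ρ := by positivity
  have hE : ∑ k, ∑ i, ∫ x in M.elem k i,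
      ‖matAct (matSqrt (M.coeff k i)) (M.grad p k i x)‖ ^ 2 = M.energyForm p p := by
    rw [M.energyForm_eq (by omega)]
    simp only [real_inner_self_eq_norm_sq]
  have hlabel : ∀ (κ : Type) [Fintype κ] (g : ∀ k, κ ↪ M.FaceLabel k),
      ∑ k, ∑ i, ∑ a, w k i (g k a) ≤ M.energyForm p p := fun κ _ g => by
    rw [← hE]
    refine Finset.sum_le_sum fun k _ => Finset.sum_le_sum fun i _ => ?_
    simpa using hws k i (Finset.univ.map (g k))
  -- The type of interior labels depends on the fracture, so `hlabel`, which has one index type for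
  -- all fractures, does not cover it.
  have hIw : ∑ k, ∑ i, ∑ j, w k i (.interior j) ≤ M.energyForm p p := by
    rw [← hE]
    refine Finset.sum_le_sum fun k _ => Finset.sum_le_sum fun i _ => ?_
    have := hws k i (Finset.univ.map ⟨.interior, fun a b h => by simpa using h⟩)
    rwa [Finset.sum_map] at this
  -- As the weights are nonnegative, the term of the owner is at most the sum over all elements with
  -- the same label; exchanging the sums then gives the bound element by element. The intersection
  -- labels are handled in the same way.
  have hDw : ∑ b, w (M.bdryOwner b).1 (M.bdryOwner b).2 (.boundary b) ≤ M.energyForm p p := by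
    refine le_trans ?_ (hlabel (Fin M.numBdry) fun k => ⟨.boundary, fun a b h => by simpa using h⟩)
    rw [Finset.sum_congr rfl fun k _ => Finset.sum_comm, Finset.sum_comm]
    refine Finset.sum_le_sum fun b _ => ?_
    refine le_trans ?_ (Finset.single_le_sum (fun k _ => Finset.sum_nonneg fun i _ => hw0 k i _)
      (Finset.mem_univ (M.bdryOwner b).1))
    exact Finset.single_le_sum (f := fun i => w (M.bdryOwner b).1 i (.boundary b))
      (fun i _ => hw0 _ i _) (Finset.mem_univ (M.bdryOwner b).2)
  have hTw : ∑ T : ∀ k, Fin (M.numElem k), ∑ k, w k (T k) (.inter T) ≤ M.energyForm p p := by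
    refine le_trans ?_ (hlabel (∀ k, Fin (M.numElem k))
      fun k => ⟨.inter, fun a b h => by simpa using h⟩)
    rw [Finset.sum_comm]
    refine Finset.sum_le_sum fun k _ => ?_
    rw [Finset.sum_comm]
    refine Finset.sum_le_sum fun T _ => ?_
    exact Finset.single_le_sum (f := fun i => w k i (.inter T))
      (fun i _ => hw0 _ i _) (Finset.mem_univ (T k))
  have hI : |M.intInterior fun k i j x => ⟪M.avgFlux p k i j x, M.jump q k i j x⟫| ≤
      t * (8 * ρ / σ₀) * (2 * M.energyForm p p) + t⁻¹ * M.intInterior (fun k i j x =>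
        M.sigmaInterior σ₀ k i j * ⟪M.jump q k i j x, M.jump q k i j x⟫) := by
    refine le_trans (b := ∑ k, ∑ i, ∑ j ∈ Finset.Ioi i,
      (t * (8 * ρ / σ₀) * (w k i (.interior j) + w k j (.interior i)) +
      t⁻¹ * ∫ x in M.interiorEdge k i j,
        M.sigmaInterior σ₀ k i j * ⟪M.jump q k i j x, M.jump q k i j x⟫ ∂μHE[d - 2])) ?_ ?_
    · refine (Finset.abs_sum_le_sum_abs _ _).trans (Finset.sum_le_sum fun k _ =>
        (Finset.abs_sum_le_sum_abs _ _).trans (Finset.sum_le_sum fun i _ =>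
        (Finset.abs_sum_le_sum_abs _ _).trans (Finset.sum_le_sum fun j hj => ?_)))
      exact hw.abs_interior_le hd hB hσ q ht k (Finset.mem_Ioi.1 hj).ne
    · simp only [Finset.sum_add_distrib (f := fun j => t * (8 * ρ / σ₀) * _),
        ← Finset.mul_sum]
      refine add_le_add (mul_le_mul_of_nonneg_left ?_ (by positivity)) le_rfl
      calc _ ≤ ∑ k, ∑ i, ∑ j, (w k i (.interior j) + w k j (.interior i)) :=
            Finset.sum_le_sum fun k _ => Finset.sum_le_sum fun i _ =>
              Finset.sum_le_sum_of_subset_of_nonneg (Finset.subset_univ _)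
                fun j _ _ => add_nonneg (hw0 _ _ _) (hw0 _ _ _)
        _ = ∑ k, (∑ i, ∑ j, w k i (.interior j) + ∑ i, ∑ j, w k i (.interior j)) := by
            refine Finset.sum_congr rfl fun k _ => ?_
            simp only [Finset.sum_add_distrib]
            congr 1
            exact Finset.sum_comm
        _ ≤ _ := by
            rw [Finset.sum_add_distrib]
            linarith
  have hD : |M.intDirichlet fun b x => ⟪M.avgFluxBdry p b x, M.jumpBdry q b x⟫| ≤
      t * (8 * ρ / σ₀) * M.energyForm p p + t⁻¹ * M.intDirichlet (fun b x =>
        M.sigmaBdry σ₀ b * ⟪M.jumpBdry q b x, M.jumpBdry q b x⟫) := by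
    refine (Finset.abs_sum_le_sum_abs _ _).trans
      ((Finset.sum_le_sum fun b _ => hw.abs_bdry_le hd hB hσ q ht b).trans ?_)
    rw [Finset.sum_add_distrib, ← Finset.mul_sum, ← Finset.mul_sum]
    refine add_le_add (mul_le_mul_of_nonneg_left (le_trans ?_ hDw) (by positivity)) le_rfl
    exact Finset.sum_le_sum_of_subset_of_nonneg (Finset.filter_subset _ _) fun b _ _ => hw0 _ _ _
  have hX : |M.intInter (fun T k l y => M.avgFluxInter p T k l y)
        (fun T k l y => M.jumpInter q T k l y)| ≤
      t * (8 * ρ / σ₀) * (2 * N * M.energyForm p p) +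
      t⁻¹ * M.intInter (fun T k l y => M.sigmaInter σ₀ T * M.jumpInter q T k l y)
        (fun T k l y => M.jumpInter q T k l y) := by
    refine (Finset.abs_sum_le_sum_abs _ _).trans
      ((Finset.sum_le_sum fun T _ => hw.abs_inter_le hd hN hB hσ q ht T).trans ?_)
    rw [Finset.sum_add_distrib, ← Finset.mul_sum, ← Finset.mul_sum, ← Finset.mul_sum]
    refine add_le_add (mul_le_mul_of_nonneg_left ?_ (by positivity)) le_rfl
    exact mul_le_mul_of_nonneg_left hTw (by positivity)
  unfold consistencyForm jumpForm
  refine (abs_add_le _ _).trans ((add_le_add ((abs_add_le _ _).trans (add_le_add hI hD)) hX).trans ?_)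
  apply le_of_eq
  ring

/-! ### Continuity and coercivity of the form -/

theorem abs_form_le (hd : d = 2 ∨ d = 3) (hN : 2 ≤ N) {ρ : ℝ} (hρ : 0 < ρ)
    (hM : M.PolytopicRegular ρ) {σ₀ : ℝ} (hσ : 0 < σ₀) (p q : NetFun d N) :
    |M.form σ₀ p q| ≤
      2 * (8 * ρ * (3 + 2 * N) / σ₀ + 2) * M.dgNorm σ₀ q * M.dgNorm σ₀ p := by
  set κ : ℝ := 8 * ρ * (3 + 2 * N) / σ₀ with hκ
  have hκ0 : 0 ≤ κ := by positivity
  refine le_of_forall_young (Real.sqrt_nonneg _) (Real.sqrt_nonneg _) (by positivity)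
    fun t ht => ?_
  rw [M.dgNorm_sq hd hN hσ, M.dgNorm_sq hd hN hσ, M.form_eq]
  have h1 := abs_le.1 (M.abs_energyForm_le (by omega) p q ht)
  have h2 := abs_le.1 (M.abs_jumpForm_le hd hN hσ p q ht)
  have h3 := abs_le.1 (M.abs_consistencyForm_le hd hN hρ hM hσ p q ht)
  -- The roles of p and q are exchanged here, so the reciprocal parameter is used: every term in p
  -- then carries t and every term in q carries t⁻¹. The largest resulting coefficients are 1 + κ on
  -- energies and 2 on jumps, both at most κ + 2.
  have h4 := abs_le.1 (M.abs_consistencyForm_le hd hN hρ hM hσ q p (inv_pos.2 ht))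
  rw [inv_inv] at h4
  rw [← hκ] at h3 h4
  have e1 : 0 ≤ t * M.energyForm p p := mul_nonneg ht.le (M.energyForm_self_nonneg (by omega) p)
  have e2 : 0 ≤ t⁻¹ * M.energyForm q q :=
    mul_nonneg (inv_pos.2 ht).le (M.energyForm_self_nonneg (by omega) q)
  have e3 : 0 ≤ t * M.jumpForm σ₀ p p := mul_nonneg ht.le (M.jumpForm_self_nonneg hd hN hσ p)
  have e4 : 0 ≤ t⁻¹ * M.jumpForm σ₀ q q :=
    mul_nonneg (inv_pos.2 ht).le (M.jumpForm_self_nonneg hd hN hσ q)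
  have e5 : 0 ≤ κ * (t * M.jumpForm σ₀ p p) := mul_nonneg hκ0 e3
  have e6 : 0 ≤ κ * (t⁻¹ * M.jumpForm σ₀ q q) := mul_nonneg hκ0 e4
  rw [abs_le]
  constructor <;> linarith [h1.1, h1.2, h2.1, h2.2, h3.1, h3.2, h4.1, h4.2]

theorem half_dgNorm_sq_le_form (hd : d = 2 ∨ d = 3) (hN : 2 ≤ N) {ρ : ℝ} (hρ : 0 < ρ)
    (hM : M.PolytopicRegular ρ) {σ₀ : ℝ} (hσ : 16 * (8 * ρ * (3 + 2 * N)) ≤ σ₀) (q : NetFun d N) :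
    1 / 2 * M.dgNorm σ₀ q ^ 2 ≤ M.form σ₀ q q := by
  have hρN : 0 < 8 * ρ * (3 + 2 * (N : ℝ)) := by positivity
  have hσ0 : 0 < σ₀ := lt_of_lt_of_le (by positivity) hσ
  have hκ : 8 * ρ * (3 + 2 * (N : ℝ)) / σ₀ ≤ 1 / 16 := by
    rw [div_le_iff₀ hσ0]
    linarith
  have hE := M.energyForm_self_nonneg (by omega) q
  -- With t = 4 and κ ≤ 1/16 the consistency form is at most a quarter of E + J. It is subtracted
  -- twice, which leaves one half of the squared norm.
  have h := (abs_le.1 (M.abs_consistencyForm_le hd hN hρ hM hσ0 q q (t := 4) (by norm_num))).2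
  have h2 := mul_le_mul_of_nonneg_right hκ hE
  rw [M.dgNorm_sq hd hN hσ0, M.form_eq]
  linarith

end Discretization

end FractureDG

theorem mainTheorem4 {d N : ℕ} (hd : d = 2 ∨ d = 3) (hN : 2 ≤ N)
    (G : FractureDG.FractureNetwork d N) (c : FractureDG.Coefficients G)
    (ρ : ℝ) (hρ : 0 < ρ) :
    (∀ σ₀ : ℝ, 0 < σ₀ → ∃ C : ℝ, 0 < C ∧
      ∀ M : FractureDG.Discretization G c, M.PolytopicRegular ρ →
        ∀ p ∈ M.extendedSpace, ∀ q ∈ M.extendedSpace,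
          |M.form σ₀ p q| ≤ C * M.dgNorm σ₀ q * M.dgNorm σ₀ p) ∧
    (∃ σmin : ℝ, 0 < σmin ∧ ∃ α : ℝ, 0 < α ∧
      ∀ σ₀ : ℝ, σmin ≤ σ₀ →
        ∀ M : FractureDG.Discretization G c, M.PolytopicRegular ρ →
          ∀ q ∈ M.extendedSpace, α * M.dgNorm σ₀ q ^ 2 ≤ M.form σ₀ q q) := by
  refine ⟨fun σ₀ hσ => ⟨2 * (8 * ρ * (3 + 2 * N) / σ₀ + 2), by positivity,
    fun M hM p _ q _ => M.abs_form_le hd hN hρ hM hσ p q⟩,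
    16 * (8 * ρ * (3 + 2 * N)), by positivity, 1 / 2, by norm_num,
    fun σ₀ hσ M hM q _ => M.half_dgNorm_sq_le_form hd hN hρ hM hσ q⟩
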